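/- Let $D\subset[0,1]^d$ be nonempty, compact and convex, let $T,w$ be positive integers with $w\mid T$, and put $N=T/w$. Let $\omega\in[0,1]$, and let the rewards $f_t(\beta)$ ($t\in\mathbb N$, $\beta\in D$) be a centered Gaussian process with covariance $$k\big((\beta,s),(\beta',t)\big)=k_\beta(\beta,\beta')\,(1-\omega)^{|s-t|/2},\qquad k_\beta(\beta,\beta)\le 1 \text{ for } \beta\in D .$$ Assume that for each round $1\le t\le N$ the function $f_t$ is almost surely continuously differentiable on $D$ and that there are constants $a,b>0$ such that, for all $1\le t\le N$, $1\le j\le d$ and all $L\ge 0$, $$\Pr\Big(\sup_{\beta\in D}\big|\partial f_t(\beta)/\partial\beta^{(j)}\big|\ge L\Big)\le a\,e^{-(L/b)^2}.$$ In round $t=1,2,\dots$ a point $\beta_t\in D$ is chosen and $y_t=f_t(\beta_t)+\epsilon_t$ is observed, where the $\epsilon_t\sim\mathcal N(0,\sigma_f^2)$, $\sigma_f>0$, are i.i.d. and independent of the process $f$. Fix $\delta\in(0,1)$ and, for $n\ge 1$, let $$\kappa_n=2\log\frac{\pi^2n^2}{2\delta}+2d\log\!\left(d\,b\,n^2\sqrt{\log\frac{d\,a\,\pi^2n^2}{2\delta}}\right),$$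 so that $\kappa_{T/w}$ is the case $n=T/w$. Let $\beta_t$ be chosen by time-varying GP-UCB: $\beta_t$ maximizes $\mu_t(\beta)+\sqrt{\kappa_t}\,\sigma_t(\beta)$ over $\beta\in D$ (ties being broken by a measurable rule depending only on past observations; $\sqrt{x}:=0$ for $x<0$), where $\mu_t$ and $\sigma_t^2$ are the Gaussian process posterior mean and variance at $x=(\beta,t)$ given the observations $y_1,\dots,y_{t-1}$ at $x_s=(\beta_s,s)$, $s<t$: $$\mu_t(\beta)=\mathbf k^{\top}(\mathbf K+\sigma_f^2 I)^{-1}\mathbf y,\qquad \sigma_t^2(\beta)=k(x,x)-\mathbf k^{\top}(\mathbf K+\sigma_f^2 I)^{-1}\mathbf k,$$ with $\mathbf K=[k(x_r,x_s)]_{r,s<t}$, $\mathbf k=[k(x_s,x)]_{s<t}$, $\mathbf y=[y_s]_{s<t}$ (in round $1$ these are the prior mean and variance). Let $$\gamma_N=\max_{\beta_1,\dots,\beta_N\in D}\tfrac12\log\det\!\big(I+\sigma_f^{-2}[k((\beta_s,s),(\beta_t,t))]_{s,t\le N}\big)$$ be the maximum information gain, and let $C_1=8/\log(1+\sigma_f^{-2})$.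 Then, with probability at least $1-\delta$, $$R_{T/w}=\sum_{t=1}^{T/w}\Big(\max_{\beta\in D}f_t(\beta)-f_t(\beta_t)\Big)\le\sqrt{\gamma_{T/w}\cdot C_1\cdot\kappa_{T/w}\cdot T/w}+2 .$$ -/

import Mathlib

open MeasureTheory ProbabilityTheory Matrix
open scoped NNReal ENNReal

namespace TVGP

noncomputable section

/-- The time kernel `k_T(s, t) = (1 - ω)^{|s - t| / 2}` (with `0 ^ 0 = 1` for `ω = 1`, `s = t`). -/
def timeKernel (ω : ℝ) (s t : ℕ) : ℝ := (1 - ω) ^ (|(s : ℝ) - (t : ℝ)| / 2)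

/-- The product kernel `k((β, s), (β', t)) = k_β(β, β') * k_T(s, t)` on pairs (arm, round). -/
def productKernel {d : ℕ} (kβ : (Fin d → ℝ) → (Fin d → ℝ) → ℝ) (ω : ℝ)
    (p q : (Fin d → ℝ) × ℕ) : ℝ :=
  kβ p.1 q.1 * timeKernel ω p.2 q.2

/-- The Gram matrix `[k(x_i, x_j)]_{i, j}` of a kernel at the points `x_0, …, x_{n-1}`. -/
def gram {I : Type*} (k : I → I → ℝ) {n : ℕ} (x : Fin n → I) : Matrix (Fin n) (Fin n) ℝ :=
  Matrix.of fun i j => k (x i) (x j)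

/-- The vector `[k(x_0, p), …, k(x_{n-1}, p)]`. -/
def kernelVec {I : Type*} (k : I → I → ℝ) {n : ℕ} (x : Fin n → I) (p : I) : Fin n → ℝ :=
  fun i => k (x i) p

/-- GP posterior mean at `p` after observing the noisy values `y` at the points `x`,
with noise variance `v`. -/
def posteriorMean {I : Type*} (k : I → I → ℝ) (v : ℝ) {n : ℕ} (x : Fin n → I)
    (y : Fin n → ℝ) (p : I) : ℝ :=
  kernelVec k x p ⬝ᵥ ((gram k x + v • (1 : Matrix (Fin n) (Fin n) ℝ))⁻¹ *ᵥ y)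

/-- GP posterior variance at `p` after noisy observations at the points `x`,
with noise variance `v`. -/
def posteriorVar {I : Type*} (k : I → I → ℝ) (v : ℝ) {n : ℕ} (x : Fin n → I) (p : I) : ℝ :=
  k p p - kernelVec k x p ⬝ᵥ
    ((gram k x + v • (1 : Matrix (Fin n) (Fin n) ℝ))⁻¹ *ᵥ kernelVec k x p)

/-- The upper confidence bound `μ(p) + √κ σ(p)`. -/
def ucb {I : Type*} (k : I → I → ℝ) (v κ : ℝ) {n : ℕ} (x : Fin n → I)
    (y : Fin n → ℝ) (p : I) : ℝ :=
  posteriorMean k v x y p + Real.sqrt κ * Real.sqrt (posteriorVar k v x p)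

/-- The exploration parameter after `n` rounds,
`2 log(π² n² / (2δ)) + 2 d log(d b n² √(log(d a π² n² / (2δ))))`. -/
def explorationParam (d : ℕ) (a b δ : ℝ) (n : ℕ) : ℝ :=
  2 * Real.log (Real.pi ^ 2 * (n : ℝ) ^ 2 / (2 * δ)) +
    2 * (d : ℝ) * Real.log ((d : ℝ) * b * (n : ℝ) ^ 2 *
      Real.sqrt (Real.log ((d : ℝ) * a * Real.pi ^ 2 * (n : ℝ) ^ 2 / (2 * δ))))

/-- The mutual information `½ log det(I + v⁻¹ K)` between the values of a GP with kernel `k`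
at the points `x` and their observations under Gaussian noise of variance `v`. -/
def infoGain {I : Type*} (k : I → I → ℝ) (v : ℝ) {n : ℕ} (x : Fin n → I) : ℝ :=
  1 / 2 * Real.log (1 + v⁻¹ • gram k x).det

/-- The maximum information gain over `n` rounds: the supremum of the mutual information over all
`β_1, …, β_n ∈ D`, where `β_t` is pulled in round `t`. -/
def maxInfoGain {d : ℕ} (k : (Fin d → ℝ) × ℕ → (Fin d → ℝ) × ℕ → ℝ) (v : ℝ)
    (D : Set (Fin d → ℝ)) (n : ℕ) : ℝ :=
  ⨆ β : Fin n → D, infoGain k v fun i => ((β i : Fin d → ℝ), (i : ℕ) + 1)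

/-- `f_t ∼ GP(0, k)` on the arms in `D`: the family `f_t(β)`, `t ∈ ℕ`, `β ∈ D`, consists of jointly
Gaussian random variables with mean `0` and covariances `k((β, s), (β', t))`. -/
structure IsCenteredGP {d : ℕ} {Ω : Type*} [MeasurableSpace Ω] (P : Measure Ω)
    (k : (Fin d → ℝ) × ℕ → (Fin d → ℝ) × ℕ → ℝ) (D : Set (Fin d → ℝ))
    (f : ℕ → Ω → (Fin d → ℝ) → ℝ) : Prop where
  measurable : ∀ t, ∀ β ∈ D, Measurable fun z => f t z β
  gaussian : IsGaussianProcess (fun (p : ℕ × D) (z : Ω) => f p.1 z p.2) P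
  mean_zero : ∀ t, ∀ β ∈ D, ∫ z, f t z β ∂P = 0
  covariance_eq : ∀ s t, ∀ β ∈ D, ∀ β' ∈ D,
    cov[fun z => f s z β, fun z => f t z β'; P] = k (β, s) (β', t)

/-- The `ε_t` are i.i.d. `N(0, v)` and independent of the process `(f_t(β))`, `t ∈ ℕ`, `β ∈ D`. -/
structure IsNoise {d : ℕ} {Ω : Type*} [MeasurableSpace Ω] (P : Measure Ω)
    (v : ℝ≥0) (D : Set (Fin d → ℝ)) (f : ℕ → Ω → (Fin d → ℝ) → ℝ) (ε : ℕ → Ω → ℝ) : Prop where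
  measurable : ∀ t, Measurable (ε t)
  law : ∀ t, P.map (ε t) = gaussianReal 0 v
  iIndep : iIndepFun ε P
  indep_reward : IndepFun (fun (z : Ω) (p : ℕ × D) => f p.1 z p.2) (fun z t => ε t z) P

/-- `h` is continuously differentiable on `D` with partial derivatives `g · j`
(which `h` determines on `D` whenever `D` is convex with nonempty interior). -/
def HasContinuousGradientOn {d : ℕ} (h : (Fin d → ℝ) → ℝ) (g : (Fin d → ℝ) → Fin d → ℝ)
    (D : Set (Fin d → ℝ)) : Prop :=
  ContinuousOn g D ∧ ∀ x ∈ D, HasFDerivWithinAt h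
    (∑ j, g x j • (ContinuousLinearMap.proj j : (Fin d → ℝ) →L[ℝ] ℝ)) D x

/-- A bandit policy: `φ n y` is the arm pulled in round `n + 1` when the rewards observed in the
rounds `1, …, n` are `y 0, …, y (n - 1)`. The points (arm, round) visited in these rounds are: -/
def visited {d : ℕ} (φ : (n : ℕ) → (Fin n → ℝ) → (Fin d → ℝ)) (n : ℕ) (y : Fin n → ℝ) :
    Fin n → (Fin d → ℝ) × ℕ :=
  fun i => (φ i fun j : Fin (i : ℕ) => y (Fin.castLE i.is_lt.le j), (i : ℕ) + 1)

/-- Time-varying GP-UCB: in round `n + 1` the policy pulls an arm of `D` that maximizes, over `D`,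
the upper confidence bound for round `n + 1` given all past observations, with exploration
parameter `κ (n + 1)`. Ties are broken by some measurable rule. -/
structure IsUCBPolicy {d : ℕ} (k : (Fin d → ℝ) × ℕ → (Fin d → ℝ) × ℕ → ℝ) (v : ℝ) (κ : ℕ → ℝ)
    (D : Set (Fin d → ℝ)) (φ : (n : ℕ) → (Fin n → ℝ) → (Fin d → ℝ)) : Prop where
  measurable : ∀ n, Measurable (φ n)
  mem : ∀ n y, φ n y ∈ D
  argmax : ∀ n y, ∀ β ∈ D,
    ucb k v (κ (n + 1)) (visited φ n y) y (β, n + 1) ≤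
      ucb k v (κ (n + 1)) (visited φ n y) y (φ n y, n + 1)

/-- The reward `y = g_{n+1}(β) + e_{n+1}` observed in round `n + 1` when the policy `φ` plays
against the reward functions `g` with noise `e`. -/
def observed {d : ℕ} (φ : (n : ℕ) → (Fin n → ℝ) → (Fin d → ℝ))
    (g : ℕ → (Fin d → ℝ) → ℝ) (e : ℕ → ℝ) (n : ℕ) : ℝ :=
  g (n + 1) (φ n fun i : Fin n => observed φ g e (i : ℕ)) + e (n + 1)
termination_by n
decreasing_by exact i.is_lt

/-- The arm pulled in round `n + 1`. -/
def pulled {d : ℕ} (φ : (n : ℕ) → (Fin n → ℝ) → (Fin d → ℝ))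
    (g : ℕ → (Fin d → ℝ) → ℝ) (e : ℕ → ℝ) (n : ℕ) : Fin d → ℝ :=
  φ n fun i : Fin n => observed φ g e (i : ℕ)

/-- The cumulative regret over the rounds `1, …, N`: the sum of `max_D g_t - g_t(β_t)`. -/
def cumulativeRegret {d : ℕ} (φ : (n : ℕ) → (Fin n → ℝ) → (Fin d → ℝ)) (D : Set (Fin d → ℝ))
    (g : ℕ → (Fin d → ℝ) → ℝ) (e : ℕ → ℝ) (N : ℕ) : ℝ :=
  ∑ n ∈ Finset.range N, (sSup (g (n + 1) '' D) - g (n + 1) (pulled φ g e n))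

end

end TVGP

/-! Write L_n for `lipschitzParam` and τ_n = d n² L_n for `resolution`. If τ_n ≥ 1, then outside
three events of probability at most 2δ/(π²n²) each, the partial derivatives of f_n are bounded by
L_n, f_n lies below its upper confidence bound on a net of at most τ_n^d points of D with ℓ¹ mesh
d/τ_n, and f_n lies above its lower confidence bound at the arm played. Since that arm maximizes the
upper confidence bound, its regret is at most 2√κ_n σ_n(β_n) + 1/n² (`sSup_sub_le_of_confidence`).
If τ_n < 1, the gradient bound alone gives regret at most 1/n². The failure probabilities sum to at
most δ because Σ 1/n² = π²/6. Cauchy–Schwarz and the chain rule for mutual information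
(`infoGain_eq_sum`, `sum_posteriorVar_le`) bound Σ √κ_n σ_n, and Σ 1/n² ≤ 2 gives the additive
constant.

The delicate point is the confidence bounds: the arms depend on past observations, so the
observations need not be jointly Gaussian. Given the reward functions, however, the density of the
observations at y is a product of Gaussian densities centred at the rewards of the arms that y
itself dictates (`lintegral_respond`). For each frozen y this is the likelihood of a fixed design,
where the regression residual is independent of the data and normal with the posterior variance
(`residual_indep_and_law`). This yields a posterior bound for almost every y. As the design varies
with y, the exceptional null sets cannot be discarded; for open target sets Fatou's lemma removes
them (`lintegral_posterior_le`). Integrating over y gives the adaptive bound (`measure_respond_le`).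
The argument runs on a space of continuous paths, where evaluation at a random arm is measurable,
and is then transferred to the original probability space. -/

/-! ### Gaussian regression residuals -/

namespace TVGP

/-- The residual of the linear regression of a Gaussian variable on noisy observations `X + e`
is independent of these observations and has the posterior variance. -/
theorem residual_indep_and_law {Θ : Type*} [MeasurableSpace Θ] {ν : Measure Θ}
    [IsProbabilityMeasure ν] {n : ℕ} {X : Fin n → Θ → ℝ} {F : Θ → ℝ} {e : Fin n → Θ → ℝ}
    (hG : HasGaussianLaw (fun θ => ((fun i => X i θ), F θ)) ν)
    (he : HasGaussianLaw (fun θ i => e i θ) ν)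
    (hind : IndepFun (fun θ => ((fun i => X i θ), F θ)) (fun θ i => e i θ) ν)
    (hX0 : ∀ i, ∫ θ, X i θ ∂ν = 0) (hF0 : ∫ θ, F θ ∂ν = 0) (he0 : ∀ i, ∫ θ, e i θ ∂ν = 0)
    {v : ℝ} {K : Matrix (Fin n) (Fin n) ℝ} {k a : Fin n → ℝ} {c : ℝ}
    (hee : ∀ i j, cov[e i, e j; ν] = if i = j then v else 0)
    (hK : ∀ i j, cov[X i, X j; ν] = K i j) (hk : ∀ i, cov[X i, F; ν] = k i)
    (hc : cov[F, F; ν] = c)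
    (ha : (K + v • (1 : Matrix (Fin n) (Fin n) ℝ)) *ᵥ a = k) :
    IndepFun (fun θ => F θ - ∑ i, a i * (X i θ + e i θ)) (fun θ i => X i θ + e i θ) ν ∧
      ν.map (fun θ => F θ - ∑ i, a i * (X i θ + e i θ)) =
        gaussianReal 0 (c - k ⬝ᵥ a).toNNReal := by
  have hall := IndepFun.hasGaussianLaw hG he hind
  have hXm : ∀ i, MemLp (X i) 2 ν := fun i => (hG.fst.eval i).memLp_two
  have hFm : MemLp F 2 ν := hG.snd.memLp_two
  have hem : ∀ i, MemLp (e i) 2 ν := fun i => (he.eval i).memLp_two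
  have hXe : ∀ i j, cov[X i, e j; ν] = 0 := fun i j =>
    IndepFun.covariance_eq_zero (hind.comp (φ := fun p : (Fin n → ℝ) × ℝ => p.1 i)
      (ψ := fun p : Fin n → ℝ => p j) (by fun_prop) (by fun_prop)) (hXm i) (hem j)
  have hFe : ∀ j, cov[F, e j; ν] = 0 := fun j =>
    IndepFun.covariance_eq_zero (hind.comp (φ := fun p : (Fin n → ℝ) × ℝ => p.2)
      (ψ := fun p : Fin n → ℝ => p j) (by fun_prop) (by fun_prop)) hFm (hem j)
  set R : Θ → ℝ := fun θ => F θ - ∑ i, a i * (X i θ + e i θ) with hR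
  have hYm : ∀ i, MemLp (fun θ => X i θ + e i θ) 2 ν := fun i => (hXm i).add (hem i)
  have hSm : MemLp (fun θ => ∑ i, a i * (X i θ + e i θ)) 2 ν :=
    memLp_finsetSum _ fun i _ => (hYm i).const_mul _
  have hRm : MemLp R 2 ν := hFm.sub hSm
  have hYY : ∀ i j, cov[fun θ => X i θ + e i θ, fun θ => X j θ + e j θ; ν] =
      (K + v • (1 : Matrix (Fin n) (Fin n) ℝ)) i j := fun i j => by
    have := covariance_add_left (hXm i) (hem i) (hYm j)
    have h2 := covariance_add_right (hXm i) (hXm j) (hem j)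
    have h3 := covariance_add_right (hem i) (hXm j) (hem j)
    simp only [Pi.add_def] at this h2 h3
    rw [this, h2, h3, hXe, hK, covariance_comm (e i) (X j), hXe, hee]
    simp [Matrix.one_apply]
  have hKsymm : ∀ i j, (K + v • (1 : Matrix (Fin n) (Fin n) ℝ)) i j =
      (K + v • (1 : Matrix (Fin n) (Fin n) ℝ)) j i := fun i j => by
    rw [← hYY, ← hYY, covariance_comm]
  have hFY : ∀ j, cov[F, fun θ => X j θ + e j θ; ν] = k j := fun j => by
    have h2 := covariance_add_right hFm (hXm j) (hem j)
    simp only [Pi.add_def] at h2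
    rw [h2, hFe, covariance_comm, hk, add_zero]
  -- The normal equations `ha` say exactly that the residual is uncorrelated with every observation.
  have hRY : ∀ j, cov[R, fun θ => X j θ + e j θ; ν] = 0 := fun j => by
    rw [hR, covariance_fun_sub_left hFm hSm (hYm j), hFY,
      covariance_fun_sum_left (fun i => (hYm i).const_mul _) (hYm j), ← ha]
    simp only [covariance_const_mul_left, hYY, Matrix.mulVec, dotProduct]
    rw [sub_eq_zero]
    exact Finset.sum_congr rfl fun i _ => by rw [hKsymm j i, mul_comm]
  -- By orthogonality to the observations, the variance of the residual equals its covariance with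
  -- `F`.
  have hvar : Var[R; ν] = c - k ⬝ᵥ a := by
    rw [← covariance_self hRm.aestronglyMeasurable.aemeasurable]
    nth_rewrite 2 [hR]
    rw [covariance_fun_sub_right hRm hFm hSm,
      covariance_fun_sum_right (fun i => (hYm i).const_mul _) hRm]
    simp only [covariance_const_mul_right, hRY, mul_zero, Finset.sum_const_zero, sub_zero]
    rw [hR, covariance_fun_sub_left hFm hSm hFm, hc,
      covariance_fun_sum_left (fun i => (hYm i).const_mul _) hFm]
    simp only [covariance_const_mul_left, dotProduct]
    congr 1
    exact Finset.sum_congr rfl fun i _ => by rw [covariance_comm, hFY, mul_comm]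
  -- The residual is viewed as a family over `Unit` because the criterion "jointly Gaussian and
  -- uncorrelated implies independent" is applied to two families of real variables.
  let Lin : (((Fin n → ℝ) × ℝ) × (Fin n → ℝ)) →L[ℝ] (Unit → ℝ) × (Fin n → ℝ) :=
    LinearMap.toContinuousLinearMap
      { toFun := fun p => (fun _ => p.1.2 - ∑ i, a i * (p.1.1 i + p.2 i),
          fun i => p.1.1 i + p.2 i)
        map_add' := fun p q => by
          ext i
          · simp only [Prod.fst_add, Prod.snd_add, Pi.add_apply, mul_add, Finset.sum_add_distrib]
            ring
          · simp only [Prod.fst_add, Prod.snd_add, Pi.add_apply]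
            ring
        map_smul' := fun r p => by
          ext i
          · simp only [Prod.smul_fst, Prod.smul_snd, Pi.smul_apply, smul_eq_mul, RingHom.id_apply,
              mul_add, Finset.sum_add_distrib, Finset.mul_sum, mul_sub]
            congr 2 <;> exact Finset.sum_congr rfl fun i _ => by ring
          · simp only [Prod.smul_fst, Prod.smul_snd, Pi.smul_apply, smul_eq_mul, RingHom.id_apply]
            ring }
  have hRYG : HasGaussianLaw (fun θ => ((fun _ : Unit => R θ), fun i => X i θ + e i θ)) ν :=
    hall.map_fun Lin
  have hR0 : ∫ θ, R θ ∂ν = 0 := by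
    rw [hR, integral_sub (hFm.integrable one_le_two) (hSm.integrable one_le_two), hF0,
      integral_finsetSum _ fun i _ => ((hYm i).const_mul _).integrable one_le_two]
    simp only [integral_const_mul]
    rw [Finset.sum_eq_zero fun i _ => ?_, sub_zero]
    rw [integral_add ((hXm i).integrable one_le_two) ((hem i).integrable one_le_two), hX0, he0]
    simp
  refine ⟨?_, ?_⟩
  · have := HasGaussianLaw.indepFun_of_covariance_eval (X := fun _ : Unit => R)
      (Y := fun i θ => X i θ + e i θ) hRYG fun _ j => hRY j
    exact this.comp (φ := fun p : Unit → ℝ => p ()) (ψ := id) (measurable_pi_apply _) measurable_id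
  · have := (hRYG.fst.eval ()).map_eq_gaussianReal
    rwa [hR0, hvar] at this

end TVGP

/-! ### Density of adaptively generated observations -/

namespace TVGP

/-- The first `i` entries of a vector. -/
def past {n : ℕ} (y : Fin n → ℝ) (i : Fin n) : Fin (i : ℕ) → ℝ :=
  fun j => y (Fin.castLE i.is_lt.le j)

/-- The observations generated recursively by the regression functions `m` and the noise `e`. -/
noncomputable def respond (m : (n : ℕ) → (Fin n → ℝ) → ℝ) : (n : ℕ) → (Fin n → ℝ) → (Fin n → ℝ)
  | 0, e => e
  | n + 1, e => Fin.snoc (α := fun _ => ℝ) (respond m n (Fin.init e))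
      (m n (respond m n (Fin.init e)) + e (Fin.last n))

/-- The density of the recursively generated observations under Gaussian noise. -/
noncomputable def likelihood (m : (n : ℕ) → (Fin n → ℝ) → ℝ) (v : ℝ≥0) {n : ℕ}
    (y : Fin n → ℝ) : ℝ≥0∞ :=
  ∏ i : Fin n, gaussianPDF (m i (past y i)) v (y i)

theorem measurable_past {n : ℕ} (i : Fin n) : Measurable fun y : Fin n → ℝ => past y i :=
  measurable_pi_iff.2 fun _ => measurable_pi_apply _

theorem past_snoc_castSucc {n : ℕ} (y : Fin n → ℝ) (x : ℝ) (i : Fin n) :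
    past (Fin.snoc (α := fun _ => ℝ) y x : Fin (n + 1) → ℝ) i.castSucc = past y i := by
  funext j
  exact Fin.snoc_castSucc (α := fun _ => ℝ) x y (Fin.castLE i.is_lt.le j)

theorem past_snoc_last {n : ℕ} (y : Fin n → ℝ) (x : ℝ) :
    past (Fin.snoc (α := fun _ => ℝ) y x : Fin (n + 1) → ℝ) (Fin.last n) = y := by
  funext j
  exact Fin.snoc_castSucc (α := fun _ => ℝ) x y j

theorem likelihood_snoc (m : (n : ℕ) → (Fin n → ℝ) → ℝ) (v : ℝ≥0) {n : ℕ}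
    (y : Fin n → ℝ) (x : ℝ) :
    likelihood m v (Fin.snoc (α := fun _ => ℝ) y x : Fin (n + 1) → ℝ) =
      likelihood m v y * gaussianPDF (m n y) v x := by
  rw [likelihood, Fin.prod_univ_castSucc]
  congr 1
  · refine Finset.prod_congr rfl fun i _ => ?_
    rw [past_snoc_castSucc, Fin.snoc_castSucc]
    rfl
  · rw [past_snoc_last, Fin.snoc_last]
    rfl

theorem measurable_snoc {n : ℕ} :
    Measurable fun p : (Fin n → ℝ) × ℝ => (Fin.snoc (α := fun _ => ℝ) p.1 p.2 : Fin (n + 1) → ℝ) := by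
  refine measurable_pi_iff.2 fun i => ?_
  refine Fin.lastCases ?_ (fun j => ?_) i
  · simpa using measurable_snd
  · simp only [Fin.snoc_castSucc]
    exact (measurable_pi_apply j).comp measurable_fst

theorem measurable_respond {Θ : Type*} [MeasurableSpace Θ]
    {m : Θ → (n : ℕ) → (Fin n → ℝ) → ℝ} {N : ℕ}
    (hm : ∀ n < N, Measurable fun p : Θ × (Fin n → ℝ) => m p.1 n p.2) :
    ∀ n ≤ N, Measurable fun p : Θ × (Fin n → ℝ) => respond (m p.1) n p.2
  | 0, _ => measurable_snd
  | n + 1, hn => by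
    have ih := measurable_respond hm n (Nat.le_of_succ_le hn)
    have hinit : Measurable fun p : Θ × (Fin (n + 1) → ℝ) =>
        (p.1, (Fin.init p.2 : Fin n → ℝ)) :=
      measurable_fst.prodMk (measurable_pi_iff.2 fun i =>
        (measurable_pi_apply i.castSucc).comp measurable_snd)
    have h1 : Measurable fun p : Θ × (Fin (n + 1) → ℝ) => respond (m p.1) n (Fin.init p.2) :=
      ih.comp hinit
    have h2 : Measurable fun p : Θ × (Fin (n + 1) → ℝ) =>
        m p.1 n (respond (m p.1) n (Fin.init p.2)) :=
      (hm n hn).comp (measurable_fst.prodMk h1)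
    exact measurable_snoc.comp (h1.prodMk
      (h2.add ((measurable_pi_apply (Fin.last n)).comp measurable_snd)))

theorem measurable_gaussianPDF_comp {α : Type*} [MeasurableSpace α] {f g : α → ℝ} (v : ℝ≥0)
    (hf : Measurable f) (hg : Measurable g) : Measurable fun a => gaussianPDF (f a) v (g a) :=
  measurable_uncurry_gaussianPDF.comp (hf.prodMk ((measurable_const (a := v)).prodMk hg))

theorem measurable_likelihood {Θ : Type*} [MeasurableSpace Θ]
    {m : Θ → (n : ℕ) → (Fin n → ℝ) → ℝ} {n : ℕ} (v : ℝ≥0)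
    (hm : ∀ i < n, Measurable fun p : Θ × (Fin i → ℝ) => m p.1 i p.2) :
    Measurable fun p : Θ × (Fin n → ℝ) => likelihood (m p.1) v p.2 := by
  refine Finset.measurable_prod _ fun i _ => ?_
  have h1 : Measurable fun p : Θ × (Fin n → ℝ) => m p.1 i (past p.2 i) :=
    (hm i i.is_lt).comp (measurable_fst.prodMk ((measurable_past i).comp measurable_snd))
  exact measurable_gaussianPDF_comp v h1 ((measurable_pi_apply i).comp measurable_snd)

theorem lintegral_pi_succ {n : ℕ} (μ : Measure ℝ) [SigmaFinite μ]
    {G : (Fin (n + 1) → ℝ) → ℝ≥0∞} (hG : Measurable G) :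
    ∫⁻ e, G e ∂(Measure.pi fun _ => μ) =
      ∫⁻ e, ∫⁻ x, G (Fin.snoc (α := fun _ => ℝ) e x) ∂μ ∂(Measure.pi fun _ : Fin n => μ) := by
  have h := (measurePreserving_piFinSuccAbove (fun _ : Fin (n + 1) => μ) (Fin.last n)).symm
  rw [← h.lintegral_comp hG]
  refine (lintegral_prod_symm _ (hG.comp h.measurable).aemeasurable).trans ?_
  refine lintegral_congr fun e => lintegral_congr fun x => ?_
  simp only [MeasurableEquiv.piFinSuccAbove_symm_apply, Fin.insertNthEquiv_last]
  rfl

theorem lintegral_gaussianReal_add {v : ℝ≥0} (hv : v ≠ 0) (c : ℝ) {g : ℝ → ℝ≥0∞}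
    (hg : Measurable g) :
    ∫⁻ x, g (c + x) ∂gaussianReal 0 v = ∫⁻ x, gaussianPDF c v x * g x := by
  rw [← lintegral_map hg (by fun_prop : Measurable fun x : ℝ => c + x),
    gaussianReal_map_const_add, zero_add, gaussianReal_of_var_ne_zero _ hv,
    lintegral_withDensity_eq_lintegral_mul _ (measurable_gaussianPDF _ _) hg]
  rfl

/-- The law of the recursively generated observations has density `likelihood`. -/
theorem lintegral_respond {m : (n : ℕ) → (Fin n → ℝ) → ℝ} {v : ℝ≥0} (hv : v ≠ 0)
    (n : ℕ) (hm : ∀ i < n, Measurable (m i)) (G : (Fin n → ℝ) → ℝ≥0∞) (hG : Measurable G) :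
    ∫⁻ e, G (respond m n e) ∂(Measure.pi fun _ => gaussianReal 0 v) =
      ∫⁻ y, likelihood m v y * G y := by
  induction n with
  | zero =>
    simp only [respond, likelihood, Finset.univ_eq_empty, Finset.prod_empty, one_mul]
    rw [volume_pi, Measure.pi_of_empty, Measure.pi_of_empty]
  | succ n ih =>
    have hm' : ∀ i < n + 1, Measurable fun p : Unit × (Fin i → ℝ) => m i p.2 :=
      fun i hi => (hm i hi).comp measurable_snd
    have hpair : ∀ k, Measurable fun e : Fin k → ℝ => ((), e) :=
      fun k => measurable_const.prodMk measurable_id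
    have hr : Measurable (respond m (n + 1)) :=
      (measurable_respond (m := fun _ : Unit => m) hm' _ le_rfl).comp (hpair _)
    have hl : Measurable fun y : Fin (n + 1) → ℝ => likelihood m v y :=
      Finset.measurable_prod _ fun i _ => measurable_gaussianPDF_comp v
        ((hm i i.is_lt).comp (measurable_past i)) (measurable_pi_apply i)
    have hGs : Measurable fun p : (Fin n → ℝ) × ℝ =>
        G (Fin.snoc (α := fun _ => ℝ) p.1 p.2) := hG.comp measurable_snoc
    have hpdf : Measurable fun p : (Fin n → ℝ) × ℝ => gaussianPDF (m n p.1) v p.2 :=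
      measurable_gaussianPDF_comp v ((hm n n.lt_succ_self).comp measurable_fst) measurable_snd
    have hH : Measurable fun y : Fin n → ℝ =>
        ∫⁻ x, gaussianPDF (m n y) v x * G (Fin.snoc (α := fun _ => ℝ) y x) :=
      Measurable.lintegral_prod_right' (ν := (volume : Measure ℝ))
        (f := fun p : (Fin n → ℝ) × ℝ =>
          gaussianPDF (m n p.1) v p.2 * G (Fin.snoc (α := fun _ => ℝ) p.1 p.2)) (hpdf.mul hGs)
    rw [lintegral_pi_succ _ (G := fun e => G (respond m (n + 1) e)) (hG.comp hr), volume_pi,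
      lintegral_pi_succ _ (G := fun y => likelihood m v y * G y) (hl.mul hG)]
    -- Integrating out the last noise variable leaves a function of the first `n` observations, to
    -- which the induction hypothesis applies.
    refine Eq.trans ?_ ((ih (fun i hi => hm i (hi.trans n.lt_succ_self)) _ hH).trans ?_)
    · refine lintegral_congr fun e => ?_
      simp only [respond, Fin.init_snoc, Fin.snoc_last]
      exact lintegral_gaussianReal_add hv _
        (g := fun x => G (Fin.snoc (α := fun _ => ℝ) (respond m n e) x))
        (hGs.comp measurable_prodMk_left)
    · refine lintegral_congr fun y => ?_
      have hy : Measurable fun x : ℝ =>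
          gaussianPDF (m n y) v x * G (Fin.snoc (α := fun _ => ℝ) y x) :=
        (measurable_gaussianPDF _ _).mul (hGs.comp measurable_prodMk_left)
      rw [← lintegral_const_mul _ hy]
      refine lintegral_congr fun x => ?_
      rw [likelihood_snoc, mul_assoc]

theorem respond_const (m : ℕ → ℝ) : ∀ (n : ℕ) (e : Fin n → ℝ) (i : Fin n),
    respond (fun k _ => m k) n e i = m i + e i
  | 0, _, i => i.elim0
  | n + 1, e, i => by
    refine Fin.lastCases ?_ (fun j => ?_) i
    · simp [respond]
    · rw [respond, Fin.snoc_castSucc, respond_const m n]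
      rfl

/-- Translated Gaussian noise has a product of Gaussian densities. -/
theorem lintegral_pi_gaussianReal_add {v : ℝ≥0} (hv : v ≠ 0) {n : ℕ} (x : Fin n → ℝ)
    {G : (Fin n → ℝ) → ℝ≥0∞} (hG : Measurable G) :
    ∫⁻ e, G (fun i => x i + e i) ∂(Measure.pi fun _ => gaussianReal 0 v) =
      ∫⁻ y, (∏ i, gaussianPDF (x i) v (y i)) * G y := by
  -- A fixed design is an adaptive one with constant regression functions; the value 0 beyond `n` is
  -- never used.
  let m : ℕ → ℝ := fun k => if h : k < n then x ⟨k, h⟩ else 0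
  have hm : ∀ i : Fin n, m i = x i := fun i => by simp [m]
  have h := lintegral_respond (m := fun k _ => m k) hv n (fun _ _ => measurable_const) G hG
  have hr : ∀ e : Fin n → ℝ, respond (fun k _ => m k) n e = fun i => x i + e i := fun e =>
    funext fun i => by rw [respond_const, hm]
  simpa only [hr, likelihood, hm] using h

end TVGP

/-! ### Posterior bounds for a fixed design, almost everywhere -/

namespace TVGP

/-- Bayes' formula for a fixed design: after Tonelli, the inner integral on the right is the
unnormalised posterior given `y`. -/
theorem lintegral_noisy_observation {Θ : Type*} [MeasurableSpace Θ] {ν : Measure Θ}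
    [IsProbabilityMeasure ν] {n : ℕ} {X : Fin n → Θ → ℝ} (hX : ∀ i, Measurable (X i))
    {v : ℝ≥0} (hv : v ≠ 0) {G : Θ × (Fin n → ℝ) → ℝ≥0∞} (hG : Measurable G) :
    ∫⁻ p, G (p.1, fun i => X i p.1 + p.2 i) ∂(ν.prod (Measure.pi fun _ => gaussianReal 0 v)) =
      ∫⁻ y : Fin n → ℝ, ∫⁻ θ, (∏ i, gaussianPDF (X i θ) v (y i)) * G (θ, y) ∂ν := by
  have hw : Measurable fun p : Θ × (Fin n → ℝ) => ∏ i, gaussianPDF (X i p.1) v (p.2 i) :=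
    Finset.measurable_prod _ fun i _ => measurable_gaussianPDF_comp v
      ((hX i).comp measurable_fst) ((measurable_pi_apply i).comp measurable_snd)
  have hmap : Measurable fun p : Θ × (Fin n → ℝ) => (p.1, fun i => X i p.1 + p.2 i) :=
    measurable_fst.prodMk (measurable_pi_iff.2 fun i =>
      ((hX i).comp measurable_fst).add ((measurable_pi_apply i).comp measurable_snd))
  refine (lintegral_prod _ (hG.comp hmap).aemeasurable).trans ?_
  rw [lintegral_lintegral_swap (f := fun (y : Fin n → ℝ) (θ : Θ) =>
    (∏ i, gaussianPDF (X i θ) v (y i)) * G (θ, y))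
    ((hw.mul hG).comp measurable_swap).aemeasurable]
  exact lintegral_congr fun θ => lintegral_pi_gaussianReal_add hv (fun i => X i θ)
    (G := fun y => G (θ, y)) (hG.comp measurable_prodMk_left)

theorem map_eval_pi_gaussianReal {n : ℕ} (v : ℝ≥0) (i : Fin n) :
    (Measure.pi fun _ => gaussianReal 0 v).map (fun e : Fin n → ℝ => e i) = gaussianReal 0 v :=
  (measurePreserving_eval (fun _ : Fin n => gaussianReal 0 v) i).map_eq

theorem covariance_eval_pi_gaussianReal {n : ℕ} (v : ℝ≥0) (i j : Fin n) :
    cov[fun e : Fin n → ℝ => e i, fun e => e j; Measure.pi fun _ => gaussianReal 0 v] =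
      if i = j then (v : ℝ) else 0 := by
  have hmp := fun i : Fin n => measurePreserving_eval (fun _ : Fin n => gaussianReal 0 v) i
  have hL : ∀ i : Fin n, MemLp (fun e : Fin n → ℝ => e i) 2
      (Measure.pi fun _ => gaussianReal 0 v) := fun i =>
    (memLp_id_gaussianReal (μ := 0) (v := v) 2).comp_measurePreserving (hmp i)
  split_ifs with h
  · subst h
    rw [covariance_self (measurable_pi_apply i).aemeasurable]
    have := variance_map (X := id) (Y := fun e : Fin n → ℝ => e i)
      (μ := Measure.pi fun _ => gaussianReal 0 v) aemeasurable_id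
      (measurable_pi_apply i).aemeasurable
    rw [Function.id_comp] at this
    rw [← this]
    rw [map_eval_pi_gaussianReal, variance_id_gaussianReal]
  · exact ((iIndepFun_pi (X := fun _ => id) (μ := fun _ : Fin n => gaussianReal 0 v)
      fun _ => aemeasurable_id).indepFun h).covariance_eq_zero (hL i) (hL j)

theorem hasGaussianLaw_pi_gaussianReal {n : ℕ} (v : ℝ≥0) :
    HasGaussianLaw (fun (e : Fin n → ℝ) i => e i) (Measure.pi fun _ => gaussianReal 0 v) := by
  refine iIndepFun.hasGaussianLaw (fun i => ⟨?_⟩)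
    (iIndepFun_pi (X := fun _ => id) (μ := fun _ : Fin n => gaussianReal 0 v)
      fun _ => aemeasurable_id)
  have h : IsGaussian (gaussianReal 0 v) := inferInstance
  rwa [← map_eval_pi_gaussianReal v i] at h

theorem residual_prod_pi_gaussianReal {Θ : Type*} [MeasurableSpace Θ] {ν : Measure Θ}
    [IsProbabilityMeasure ν] {n : ℕ} {X : Fin n → Θ → ℝ} {F : Θ → ℝ}
    (hXm : ∀ i, Measurable (X i)) (hFm : Measurable F)
    (hG : HasGaussianLaw (fun θ => ((fun i => X i θ), F θ)) ν)
    (hX0 : ∀ i, ∫ θ, X i θ ∂ν = 0) (hF0 : ∫ θ, F θ ∂ν = 0)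
    {v : ℝ≥0} {K : Matrix (Fin n) (Fin n) ℝ} {k a : Fin n → ℝ} {c : ℝ}
    (hK : ∀ i j, cov[X i, X j; ν] = K i j) (hk : ∀ i, cov[X i, F; ν] = k i)
    (hc : cov[F, F; ν] = c)
    (ha : (K + (v : ℝ) • (1 : Matrix (Fin n) (Fin n) ℝ)) *ᵥ a = k) :
    IndepFun (fun p : Θ × (Fin n → ℝ) => F p.1 - ∑ i, a i * (X i p.1 + p.2 i))
        (fun p i => X i p.1 + p.2 i) (ν.prod (Measure.pi fun _ => gaussianReal 0 v)) ∧
      (ν.prod (Measure.pi fun _ => gaussianReal 0 v)).map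
          (fun p : Θ × (Fin n → ℝ) => F p.1 - ∑ i, a i * (X i p.1 + p.2 i)) =
        gaussianReal 0 (c - k ⬝ᵥ a).toNNReal := by
  let γ : Measure (Fin n → ℝ) := Measure.pi fun _ => gaussianReal 0 v
  have hfst : (ν.prod γ).map Prod.fst = ν := (measurePreserving_fst (μ := ν) (ν := γ)).map_eq
  have hsnd : (ν.prod γ).map Prod.snd = γ := (measurePreserving_snd (μ := ν) (ν := γ)).map_eq
  have hpair : Measurable fun θ => ((fun i => X i θ), F θ) :=
    (measurable_pi_iff.2 hXm).prodMk hFm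
  have hG' : HasGaussianLaw (fun p : Θ × (Fin n → ℝ) => ((fun i => X i p.1), F p.1))
      (ν.prod γ) := ⟨by
    have h := hG.isGaussian_map
    nth_rewrite 1 [← hfst] at h
    rwa [Measure.map_map hpair measurable_fst] at h⟩
  have he' : HasGaussianLaw (fun (p : Θ × (Fin n → ℝ)) i => p.2 i) (ν.prod γ) := ⟨by
    have h := (hasGaussianLaw_pi_gaussianReal (n := n) v).isGaussian_map
    rw [show Measure.pi (fun _ : Fin n => gaussianReal 0 v) = γ from rfl, ← hsnd,
      Measure.map_map (by fun_prop) measurable_snd] at h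
    exact h⟩
  have hcov : ∀ {A B : Θ → ℝ}, Measurable A → Measurable B →
      cov[fun p : Θ × (Fin n → ℝ) => A p.1, fun p => B p.1; ν.prod γ] = cov[A, B; ν] := by
    intro A B hA hB
    nth_rewrite 2 [← hfst]
    rw [covariance_map_fun hA.aestronglyMeasurable hB.aestronglyMeasurable
      measurable_fst.aemeasurable]
  have hint : ∀ {A : Θ → ℝ}, Measurable A →
      ∫ p, A p.1 ∂(ν.prod γ) = ∫ θ, A θ ∂ν := by
    intro A hA
    nth_rewrite 2 [← hfst]
    rw [integral_map measurable_fst.aemeasurable hA.aestronglyMeasurable]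
  have hcove : ∀ i j, cov[fun p : Θ × (Fin n → ℝ) => p.2 i, fun p => p.2 j; ν.prod γ] =
      if i = j then (v : ℝ) else 0 := by
    intro i j
    rw [← covariance_eval_pi_gaussianReal v i j,
      show Measure.pi (fun _ : Fin n => gaussianReal 0 v) = γ from rfl]
    nth_rewrite 2 [← hsnd]
    rw [covariance_map_fun (measurable_pi_apply i).aestronglyMeasurable
      (measurable_pi_apply j).aestronglyMeasurable measurable_snd.aemeasurable]
  have hinte : ∀ i, ∫ p : Θ × (Fin n → ℝ), p.2 i ∂(ν.prod γ) = 0 := by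
    intro i
    rw [← integral_map (f := fun e : Fin n → ℝ => e i) measurable_snd.aemeasurable
      (measurable_pi_apply i).aestronglyMeasurable, hsnd]
    refine (integral_map (f := (id : ℝ → ℝ)) (φ := fun e : Fin n → ℝ => e i) (measurable_pi_apply i).aemeasurable
      aestronglyMeasurable_id).symm.trans ?_
    rw [map_eval_pi_gaussianReal]
    exact integral_id_gaussianReal
  exact residual_indep_and_law (ν := ν.prod γ)
    (X := fun i p => X i p.1) (F := fun p => F p.1) (e := fun i p => p.2 i) hG' he'
    (indepFun_prod hpair measurable_id) (fun i => (hint (hXm i)).trans (hX0 i))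
    ((hint hFm).trans hF0) hinte hcove (fun i j => (hcov (hXm i) (hXm j)).trans (hK i j))
    (fun i => (hcov (hXm i) hFm).trans (hk i)) ((hcov hFm hFm).trans hc) ha

/-- Two functions of `y` whose integrals over all measurable sets are ordered are themselves ordered
almost everywhere. The sets `S` will be events of the observations, which independence lets one
test. -/
theorem ae_lintegral_mul_le_of_forall_indicator {Θ Y : Type*} [MeasurableSpace Θ]
    [MeasurableSpace Y] {ν : Measure Θ} [SFinite ν] {μ : Measure Y} [SigmaFinite μ]
    {w I : Θ × Y → ℝ≥0∞} (hw : Measurable w) (hI : Measurable I) (q : ℝ≥0∞)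
    (h : ∀ S : Set Y, MeasurableSet S →
      ∫⁻ y, ∫⁻ θ, w (θ, y) * (I (θ, y) * S.indicator 1 y) ∂ν ∂μ ≤
        q * ∫⁻ y, ∫⁻ θ, w (θ, y) * S.indicator 1 y ∂ν ∂μ) :
    ∀ᵐ y ∂μ, ∫⁻ θ, w (θ, y) * I (θ, y) ∂ν ≤ q * ∫⁻ θ, w (θ, y) ∂ν := by
  have hB : Measurable fun y => ∫⁻ θ, w (θ, y) ∂ν := hw.lintegral_prod_left'
  refine ae_le_of_forall_setLIntegral_le_of_sigmaFinite (hw.mul hI).lintegral_prod_left'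
    fun S hS _ => ?_
  have hmul : ∀ g : Y → ℝ≥0∞, ∫⁻ y in S, g y ∂μ =
      ∫⁻ y, g y * S.indicator (1 : Y → ℝ≥0∞) y ∂μ := by
    intro g
    rw [← lintegral_indicator hS]
    refine lintegral_congr fun y => ?_
    by_cases hy : y ∈ S <;> simp [hy]
  have hin : ∀ g : Θ × Y → ℝ≥0∞, Measurable g → ∀ y,
      (∫⁻ θ, g (θ, y) ∂ν) * S.indicator (1 : Y → ℝ≥0∞) y =
      ∫⁻ θ, g (θ, y) * S.indicator (1 : Y → ℝ≥0∞) y ∂ν :=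
    fun g hg y => (lintegral_mul_const _ (hg.comp measurable_prodMk_right)).symm
  rw [lintegral_const_mul _ hB, hmul, hmul]
  simp only [hin _ hw]
  refine le_trans (le_of_eq ?_) (h S hS)
  refine lintegral_congr fun y => ?_
  refine (hin _ (hw.mul hI) y).trans ?_
  exact lintegral_congr fun θ => mul_assoc _ _ _

/-- Almost everywhere version of `lintegral_posterior_le`. -/
theorem ae_lintegral_posterior_le {Θ : Type*} [MeasurableSpace Θ] {ν : Measure Θ}
    [IsProbabilityMeasure ν] {n : ℕ} {X : Fin n → Θ → ℝ} {F : Θ → ℝ}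
    (hXm : ∀ i, Measurable (X i)) (hFm : Measurable F)
    (hG : HasGaussianLaw (fun θ => ((fun i => X i θ), F θ)) ν)
    (hX0 : ∀ i, ∫ θ, X i θ ∂ν = 0) (hF0 : ∫ θ, F θ ∂ν = 0)
    {v : ℝ≥0} (hv : v ≠ 0) {K : Matrix (Fin n) (Fin n) ℝ} {k a : Fin n → ℝ} {c : ℝ}
    (hK : ∀ i j, cov[X i, X j; ν] = K i j) (hk : ∀ i, cov[X i, F; ν] = k i)
    (hc : cov[F, F; ν] = c)
    (ha : (K + (v : ℝ) • (1 : Matrix (Fin n) (Fin n) ℝ)) *ᵥ a = k)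
    {U : Set ℝ} (hU : MeasurableSet U) :
    ∀ᵐ y : Fin n → ℝ,
      ∫⁻ θ, (∏ i, gaussianPDF (X i θ) v (y i)) *
        U.indicator 1 (F θ - ∑ i, a i * y i) ∂ν ≤
      gaussianReal 0 (c - k ⬝ᵥ a).toNNReal U *
        ∫⁻ θ, (∏ i, gaussianPDF (X i θ) v (y i)) ∂ν := by
  obtain ⟨hind, hlaw⟩ := residual_prod_pi_gaussianReal hXm hFm hG hX0 hF0 hK hk hc ha
  have hw : Measurable fun p : Θ × (Fin n → ℝ) => ∏ i, gaussianPDF (X i p.1) v (p.2 i) :=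
    Finset.measurable_prod _ fun i _ => measurable_gaussianPDF_comp v
      ((hXm i).comp measurable_fst) ((measurable_pi_apply i).comp measurable_snd)
  have hI : Measurable fun p : Θ × (Fin n → ℝ) =>
      U.indicator (1 : ℝ → ℝ≥0∞) (F p.1 - ∑ i, a i * p.2 i) := by
    refine (measurable_one.indicator hU).comp (f := fun p : Θ × (Fin n → ℝ) =>
      F p.1 - ∑ i, a i * p.2 i) ?_
    fun_prop
  refine ae_lintegral_mul_le_of_forall_indicator hw hI _ fun S hS => ?_
  have hSI : Measurable fun p : Θ × (Fin n → ℝ) => S.indicator (1 : (Fin n → ℝ) → ℝ≥0∞) p.2 :=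
    (measurable_one.indicator hS).comp measurable_snd
  have hYm : Measurable fun (p : Θ × (Fin n → ℝ)) i => X i p.1 + p.2 i := by fun_prop
  have hRm : Measurable fun p : Θ × (Fin n → ℝ) => F p.1 - ∑ i, a i * (X i p.1 + p.2 i) := by
    fun_prop
  have e1 := lintegral_noisy_observation (ν := ν) hXm hv (hI.mul hSI)
  have e2 := lintegral_noisy_observation (ν := ν) hXm hv hSI
  -- Independence of residual and observations factorises the probability that the former lies in
  -- `U` and the latter in `S`.
  have e3 := lintegral_mul_eq_lintegral_mul_lintegral_of_indepFun
    ((measurable_one.indicator hU).comp hRm) ((measurable_one.indicator hS).comp hYm)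
    (hind.comp (φ := U.indicator (1 : ℝ → ℝ≥0∞)) (ψ := S.indicator (1 : (Fin n → ℝ) → ℝ≥0∞))
      (measurable_one.indicator hU) (measurable_one.indicator hS))
  have e4 : ∫⁻ p, U.indicator (1 : ℝ → ℝ≥0∞) (F p.1 - ∑ i, a i * (X i p.1 + p.2 i))
      ∂(ν.prod (Measure.pi fun _ => gaussianReal 0 v)) =
      gaussianReal 0 (c - k ⬝ᵥ a).toNNReal U := by
    rw [← hlaw, ← lintegral_map (measurable_one.indicator hU) hRm, lintegral_indicator_one hU]
  refine le_of_eq (e1.symm.trans (e3.trans ?_))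
  rw [← e2]
  exact congrArg (· * _) e4

end TVGP

/-! ### Posterior bounds for every observation, and normal tails -/

namespace TVGP

theorem gaussianPDFReal_le (m : ℝ) (v : ℝ≥0) (x : ℝ) :
    gaussianPDFReal m v x ≤ (Real.sqrt (2 * Real.pi * v))⁻¹ := by
  rw [gaussianPDFReal_def]
  refine mul_le_of_le_one_right (by positivity) (Real.exp_le_one_iff.2 ?_)
  exact div_nonpos_of_nonpos_of_nonneg (neg_nonpos.2 (sq_nonneg _)) (by positivity)

theorem continuous_prod_gaussianPDF {n : ℕ} (x : Fin n → ℝ) (v : ℝ≥0) :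
    Continuous fun y : Fin n → ℝ => ∏ i, gaussianPDF (x i) v (y i) := by
  simp only [gaussianPDF]
  simp only [← ENNReal.ofReal_prod_of_nonneg fun i (_ : i ∈ Finset.univ) =>
    gaussianPDFReal_nonneg _ _ _]
  refine ENNReal.continuous_ofReal.comp (continuous_finsetProd _ fun i _ => ?_)
  simp only [gaussianPDFReal_def]
  fun_prop

theorem prod_gaussianPDF_le {n : ℕ} (x : Fin n → ℝ) (v : ℝ≥0) (y : Fin n → ℝ) :
    ∏ i, gaussianPDF (x i) v (y i) ≤ ENNReal.ofReal (Real.sqrt (2 * Real.pi * v))⁻¹ ^ n := by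
  refine (Finset.prod_le_prod' fun i _ =>
    ENNReal.ofReal_le_ofReal (gaussianPDFReal_le (x i) v (y i))).trans ?_
  simp

/-- Under the (unnormalised) posterior given the observations `y`, the posterior mean error of a
jointly Gaussian variable is dominated by a centered normal law with the posterior variance. -/
theorem lintegral_posterior_le {Θ : Type*} [MeasurableSpace Θ] {ν : Measure Θ}
    [IsProbabilityMeasure ν] {n : ℕ} {X : Fin n → Θ → ℝ} {F : Θ → ℝ}
    (hXm : ∀ i, Measurable (X i)) (hFm : Measurable F)
    (hG : HasGaussianLaw (fun θ => ((fun i => X i θ), F θ)) ν)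
    (hX0 : ∀ i, ∫ θ, X i θ ∂ν = 0) (hF0 : ∫ θ, F θ ∂ν = 0)
    {v : ℝ≥0} (hv : v ≠ 0) {K : Matrix (Fin n) (Fin n) ℝ} {k a : Fin n → ℝ} {c : ℝ}
    (hK : ∀ i j, cov[X i, X j; ν] = K i j) (hk : ∀ i, cov[X i, F; ν] = k i)
    (hc : cov[F, F; ν] = c)
    (ha : (K + (v : ℝ) • (1 : Matrix (Fin n) (Fin n) ℝ)) *ᵥ a = k)
    {U : Set ℝ} (hU : IsOpen U) (y : Fin n → ℝ) :
      ∫⁻ θ, (∏ i, gaussianPDF (X i θ) v (y i)) *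
        U.indicator 1 (F θ - ∑ i, a i * y i) ∂ν ≤
      gaussianReal 0 (c - k ⬝ᵥ a).toNNReal U *
        ∫⁻ θ, (∏ i, gaussianPDF (X i θ) v (y i)) ∂ν := by
  have hae := ae_lintegral_posterior_le hXm hFm hG hX0 hF0 hv hK hk hc ha hU.measurableSet
  -- A set of full Lebesgue measure is dense, so `y` is a limit of observations at which the
  -- inequality holds.
  obtain ⟨u, hu, hlim⟩ := mem_closure_iff_seq_limit.1 (Measure.dense_of_ae hae y)
  have hw : ∀ z : Fin n → ℝ, Measurable fun θ => ∏ i, gaussianPDF (X i θ) v (z i) := fun z =>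
    Finset.measurable_prod _ fun i _ => measurable_gaussianPDF_comp v (hXm i) measurable_const
  have hI : ∀ z : Fin n → ℝ, Measurable fun θ =>
      U.indicator (1 : ℝ → ℝ≥0∞) (F θ - ∑ i, a i * z i) := fun z =>
    (measurable_one.indicator hU.measurableSet).comp (hFm.sub measurable_const)
  have hwlim : ∀ θ, Filter.Tendsto (fun m => ∏ i, gaussianPDF (X i θ) v (u m i)) Filter.atTop
      (nhds (∏ i, gaussianPDF (X i θ) v (y i))) := fun θ =>
    ((continuous_prod_gaussianPDF (fun i => X i θ) v).tendsto y).comp hlim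
  have hB : Filter.Tendsto (fun m => ∫⁻ θ, ∏ i, gaussianPDF (X i θ) v (u m i) ∂ν) Filter.atTop
      (nhds (∫⁻ θ, ∏ i, gaussianPDF (X i θ) v (y i) ∂ν)) := by
    refine tendsto_lintegral_of_dominated_convergence
      (fun _ => ENNReal.ofReal (Real.sqrt (2 * Real.pi * v))⁻¹ ^ n) (fun m => hw _)
      (fun m => ae_of_all _ fun θ => prod_gaussianPDF_le (fun i => X i θ) v _) ?_
      (ae_of_all _ hwlim)
    rw [lintegral_const, measure_univ, mul_one]
    exact ENNReal.pow_ne_top ENNReal.ofReal_ne_top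
  have hq : gaussianReal 0 (c - k ⬝ᵥ a).toNNReal U ≠ ∞ := measure_ne_top _ _
  have hB' := ENNReal.Tendsto.const_mul hB (Or.inr hq)
  -- The right side is continuous in the observations by dominated convergence. The left side is
  -- lower semicontinuous by Fatou: the indicator of an open set is eventually 1 along a sequence
  -- converging into it.
  refine le_trans ?_ (ge_of_eq hB'.liminf_eq.symm)
  refine le_trans ?_ (Filter.liminf_le_liminf (Filter.Eventually.of_forall fun m => hu m))
  refine le_trans ?_ (lintegral_liminf_le fun m => (hw _).mul (hI _))
  refine lintegral_mono fun θ => ?_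
  by_cases hθ : F θ - ∑ i, a i * y i ∈ U
  · have hev : ∀ᶠ m in Filter.atTop, F θ - ∑ i, a i * u m i ∈ U := by
      have hc : Continuous fun z : Fin n → ℝ => F θ - ∑ i, a i * z i := by fun_prop
      exact ((hc.tendsto y).comp hlim).eventually (hU.mem_nhds hθ)
    have : Filter.Tendsto (fun m => (∏ i, gaussianPDF (X i θ) v (u m i)) *
        U.indicator (1 : ℝ → ℝ≥0∞) (F θ - ∑ i, a i * u m i)) Filter.atTop
        (nhds (∏ i, gaussianPDF (X i θ) v (y i))) := by
      refine (hwlim θ).congr' (hev.mono fun m hm => ?_)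
      simp [hm]
    rw [this.liminf_eq]
    simp [hθ]
  · simp [hθ]

/-- Chernoff bound for the normal law. -/
theorem gaussianReal_Ioi_le (s : ℝ≥0) {c : ℝ} (hc : 0 ≤ c) :
    gaussianReal 0 s (Set.Ioi (c * Real.sqrt s)) ≤ ENNReal.ofReal (Real.exp (-(c ^ 2 / 2))) := by
  rcases eq_or_ne s 0 with rfl | hs
  · simp
  have hs' : 0 < Real.sqrt s := Real.sqrt_pos.2 (NNReal.coe_pos.2 (pos_iff_ne_zero.2 hs))
  -- The parameter c/√s minimises the Chernoff exponent -t c √s + s t²/2.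
  have h := measure_ge_le_exp_mul_mgf (X := id) (μ := gaussianReal 0 s) (t := c / Real.sqrt s)
    (c * Real.sqrt s) (by positivity)
    (integrable_exp_mul_gaussianReal _)
  rw [mgf_id_gaussianReal, ← Real.exp_add] at h
  have he : -(c / Real.sqrt s) * (c * Real.sqrt s) +
      (0 * (c / Real.sqrt s) + s * (c / Real.sqrt s) ^ 2 / 2) = -(c ^ 2 / 2) := by
    have : (s : ℝ) = Real.sqrt s ^ 2 := (Real.sq_sqrt s.coe_nonneg).symm
    nth_rewrite 4 [this]
    field_simp
    ring
  rw [he] at h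
  have hsub : Set.Ioi (c * Real.sqrt s) ⊆ {x | c * Real.sqrt s ≤ id x} := by
    intro x hx
    simp only [Set.mem_ofPred_eq, id]
    exact (Set.mem_Ioi.1 hx).le
  refine (measure_mono hsub).trans ?_
  rw [← ofReal_measureReal (measure_ne_top _ _)]
  exact ENNReal.ofReal_le_ofReal h

theorem gaussianReal_Iio_le (s : ℝ≥0) {c : ℝ} (hc : 0 ≤ c) :
    gaussianReal 0 s (Set.Iio (-(c * Real.sqrt s))) ≤
      ENNReal.ofReal (Real.exp (-(c ^ 2 / 2))) := by
  refine le_of_eq_of_le ?_ (gaussianReal_Ioi_le s hc)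
  have h := gaussianReal_map_neg (μ := 0) (v := s)
  rw [neg_zero] at h
  nth_rewrite 1 [← h]
  rw [Measure.map_apply measurable_neg measurableSet_Iio]
  congr 1
  ext x
  simp

end TVGP

/-! ### Gram matrices and measurability of posterior mean and variance -/

namespace TVGP

/-- The quadratic form of `K` at `x` is the variance of Σ x_i X_i. -/
theorem posSemidef_of_covariance {Θ ι : Type*} [MeasurableSpace Θ] {ν : Measure Θ}
    [IsFiniteMeasure ν] [Fintype ι] {X : ι → Θ → ℝ} (hX : ∀ i, MemLp (X i) 2 ν)
    {K : Matrix ι ι ℝ} (hK : ∀ i j, cov[X i, X j; ν] = K i j) : K.PosSemidef := by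
  refine PosSemidef.of_dotProduct_mulVec_nonneg ?_ fun x => ?_
  · ext i j
    simp only [conjTranspose_apply, star_trivial, ← hK, covariance_comm]
  · have hS : MemLp (fun θ => ∑ i, x i * X i θ) 2 ν :=
      memLp_finsetSum _ fun i _ => (hX i).const_mul _
    have h := variance_nonneg (fun θ => ∑ i, x i * X i θ) ν
    rw [← covariance_self hS.aestronglyMeasurable.aemeasurable,
      covariance_fun_sum_fun_sum (fun i => (hX i).const_mul _) (fun i => (hX i).const_mul _)] at h
    simp only [covariance_const_mul_left, covariance_const_mul_right, hK] at h
    simp only [star_trivial, dotProduct, mulVec, Finset.mul_sum]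
    refine h.trans_eq (Finset.sum_congr rfl fun i _ => Finset.sum_congr rfl fun j _ => ?_)
    ring

theorem posDef_add_smul_one {n : ℕ} {K : Matrix (Fin n) (Fin n) ℝ} (hK : K.PosSemidef)
    {v : ℝ} (hv : 0 < v) : (K + v • (1 : Matrix (Fin n) (Fin n) ℝ)).PosDef :=
  PosDef.posSemidef_add hK (PosDef.one.smul hv)

theorem posteriorMean_eq_sum {I : Type*} {k : I → I → ℝ} {v : ℝ} (hv : 0 < v) {n : ℕ}
    {x : Fin n → I} (hK : (gram k x).PosSemidef) (y : Fin n → ℝ) (p : I) :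
    posteriorMean k v x y p =
      ∑ i, ((gram k x + v • (1 : Matrix (Fin n) (Fin n) ℝ))⁻¹ *ᵥ kernelVec k x p) i * y i := by
  have hs : ((gram k x + v • (1 : Matrix (Fin n) (Fin n) ℝ))⁻¹)ᵀ =
      (gram k x + v • (1 : Matrix (Fin n) (Fin n) ℝ))⁻¹ := by
    have := (posDef_add_smul_one hK hv).inv.isHermitian
    rwa [IsHermitian, conjTranspose_eq_transpose_of_trivial] at this
  change _ = _ ⬝ᵥ y
  rw [posteriorMean, dotProduct_mulVec, ← mulVec_transpose, hs]

theorem measurable_det {α : Type*} [MeasurableSpace α] {n : ℕ}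
    {A : α → Matrix (Fin n) (Fin n) ℝ} (hA : ∀ i j, Measurable fun y => A y i j) :
    Measurable fun y => (A y).det := by
  simp only [det_apply']
  exact Finset.measurable_sum _ fun σ _ =>
    measurable_const.mul (Finset.measurable_prod _ fun i _ => hA _ _)

/-- Cramer's rule. Singular matrices are covered because both the matrix inverse and the inverse of
a zero determinant are 0 by convention. -/
theorem measurable_matrix_inv {α : Type*} [MeasurableSpace α] {n : ℕ}
    {A : α → Matrix (Fin n) (Fin n) ℝ} (hA : ∀ i j, Measurable fun y => A y i j) (i j : Fin n) :
    Measurable fun y => (A y)⁻¹ i j := by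
  simp only [inv_def, Ring.inverse_eq_inv', Matrix.smul_apply, smul_eq_mul, adjugate_apply]
  refine (measurable_det hA).inv.mul (measurable_det fun r s => ?_)
  by_cases h : r = j
  · simp only [h, updateRow_self]
    exact measurable_const
  · simp only [updateRow_ne h]
    exact hA r s

section Measurability

variable {α I : Type*} [MeasurableSpace α] {k : I → I → ℝ} {v : ℝ} {n : ℕ} {x : α → Fin n → I}
  {p : α → I}

theorem measurable_posterior_weights
    (hK : ∀ i j, Measurable fun a => k (x a i) (x a j)) (i j : Fin n) :
    Measurable fun a => (gram k (x a) + v • (1 : Matrix (Fin n) (Fin n) ℝ))⁻¹ i j :=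
  measurable_matrix_inv (fun i j => (hK i j).add measurable_const) i j

theorem measurable_posteriorMean {y : α → Fin n → ℝ} (hy : Measurable y)
    (hK : ∀ i j, Measurable fun a => k (x a i) (x a j))
    (hk : ∀ i, Measurable fun a => k (x a i) (p a)) :
    Measurable fun a => posteriorMean k v (x a) (y a) (p a) := by
  simp only [posteriorMean, dotProduct, mulVec]
  exact Finset.measurable_sum _ fun i _ => (hk i).mul (Finset.measurable_sum _ fun j _ =>
    (measurable_posterior_weights hK i j).mul ((measurable_pi_apply j).comp hy))

theorem measurable_posteriorVar
    (hK : ∀ i j, Measurable fun a => k (x a i) (x a j))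
    (hk : ∀ i, Measurable fun a => k (x a i) (p a)) (hp : Measurable fun a => k (p a) (p a)) :
    Measurable fun a => posteriorVar k v (x a) (p a) := by
  simp only [posteriorVar, dotProduct, mulVec]
  exact hp.sub (Finset.measurable_sum _ fun i _ => (hk i).mul (Finset.measurable_sum _ fun j _ =>
    (measurable_posterior_weights hK i j).mul (hk j)))

end Measurability

end TVGP

/-! ### From fixed designs to adaptive observations -/

namespace TVGP

/-- Here `w (θ, ·)` is the density of the data given `θ`. Tonelli turns the probability into an
integral over `y` of unnormalised posterior masses; after the pointwise bound, Tonelli back leaves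
`q` because each density integrates to 1. -/
theorem measure_preimage_le_of_lintegral_eq {Θ Y : Type*} [MeasurableSpace Θ] [MeasurableSpace Y]
    {ν : Measure Θ} [IsProbabilityMeasure ν] {γ μ : Measure Y} [IsProbabilityMeasure γ] [SFinite μ]
    {w : Θ × Y → ℝ≥0∞} (hw : Measurable w) {r : Θ × Y → Y} (hr : Measurable r)
    (hrw : ∀ θ, ∀ G : Y → ℝ≥0∞, Measurable G →
      ∫⁻ e, G (r (θ, e)) ∂γ = ∫⁻ y, w (θ, y) * G y ∂μ)
    {W : Set (Θ × Y)} (hW : MeasurableSet W) {q : ℝ≥0∞}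
    (h : ∀ y, ∫⁻ θ, w (θ, y) * W.indicator 1 (θ, y) ∂ν ≤ q * ∫⁻ θ, w (θ, y) ∂ν) :
    (ν.prod γ) {p | (p.1, r p) ∈ W} ≤ q := by
  have hr' : Measurable fun p : Θ × Y => (p.1, r p) := measurable_fst.prodMk hr
  have hI : Measurable fun p => W.indicator (1 : Θ × Y → ℝ≥0∞) p := measurable_one.indicator hW
  have hone : ∀ θ, ∫⁻ y, w (θ, y) ∂μ = 1 := fun θ => by
    have := hrw θ 1 measurable_one
    simp only [Pi.one_apply, mul_one, lintegral_one, measure_univ] at this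
    exact this.symm
  calc _ = ∫⁻ p, W.indicator 1 (p.1, r p) ∂(ν.prod γ) := 
        (lintegral_indicator_one (hr' hW)).symm
    _ = ∫⁻ θ, ∫⁻ e, W.indicator 1 (θ, r (θ, e)) ∂γ ∂ν :=
        lintegral_prod _ (hI.comp hr').aemeasurable
    _ = ∫⁻ θ, ∫⁻ y, w (θ, y) * W.indicator 1 (θ, y) ∂μ ∂ν :=
        lintegral_congr fun θ =>
          hrw θ (fun y => W.indicator 1 (θ, y)) (hI.comp measurable_prodMk_left)
    _ = ∫⁻ y, ∫⁻ θ, w (θ, y) * W.indicator 1 (θ, y) ∂ν ∂μ :=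
        lintegral_lintegral_swap (hw.mul hI).aemeasurable
    _ ≤ ∫⁻ y, q * ∫⁻ θ, w (θ, y) ∂ν ∂μ := lintegral_mono h
    _ = q * ∫⁻ y, ∫⁻ θ, w (θ, y) ∂ν ∂μ := lintegral_const_mul _ hw.lintegral_prod_left'
    _ = q * ∫⁻ θ, ∫⁻ y, w (θ, y) ∂μ ∂ν := by
        rw [lintegral_lintegral_swap (f := fun θ y => w (θ, y)) hw.aemeasurable]
    _ = q := by simp [hone]

/-- A bound on the unnormalised posterior probabilities, uniform in the observations, bounds the
probability of an event that depends on adaptively generated observations. -/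
theorem measure_respond_le {Θ : Type*} [MeasurableSpace Θ] {ν : Measure Θ}
    [IsProbabilityMeasure ν] {m : Θ → (n : ℕ) → (Fin n → ℝ) → ℝ} {n : ℕ} {v : ℝ≥0} (hv : v ≠ 0)
    (hm : ∀ i < n, Measurable fun p : Θ × (Fin i → ℝ) => m p.1 i p.2)
    {W : Set (Θ × (Fin n → ℝ))} (hW : MeasurableSet W) {q : ℝ≥0∞}
    (h : ∀ y, ∫⁻ θ, likelihood (m θ) v y * W.indicator 1 (θ, y) ∂ν ≤
      q * ∫⁻ θ, likelihood (m θ) v y ∂ν) :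
    (ν.prod (Measure.pi fun _ => gaussianReal 0 v)) {p | (p.1, respond (m p.1) n p.2) ∈ W} ≤ q :=
  measure_preimage_le_of_lintegral_eq (μ := volume)
    (w := fun p : Θ × (Fin n → ℝ) => likelihood (m p.1) v p.2)
    (measurable_likelihood v hm) (measurable_respond hm n le_rfl)
    (fun _ G hG => lintegral_respond hv n
      (fun i hi => (hm i hi).comp measurable_prodMk_left) G hG) hW h

variable {d : ℕ} {Θ : Type*} [MeasurableSpace Θ]

/-- A jointly measurable centered Gaussian process with covariance `k` in the rounds
`1, …, N`. -/
structure IsRewardModel (ν : Measure Θ) (k : (Fin d → ℝ) × ℕ → (Fin d → ℝ) × ℕ → ℝ)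
    (D : Set (Fin d → ℝ)) (N : ℕ) (h : Θ → ℕ → D → ℝ) : Prop where
  measurable : ∀ t, Measurable fun p : Θ × D => h p.1 t p.2
  gaussian : IsGaussianProcess (fun (p : ℕ × D) (θ : Θ) => h θ p.1 p.2) ν
  mean_zero : ∀ t β, ∫ θ, h θ t β ∂ν = 0
  covariance_eq : ∀ s ∈ Finset.Icc 1 N, ∀ t ∈ Finset.Icc 1 N, ∀ β β' : D,
    cov[fun θ => h θ s β, fun θ => h θ t β'; ν] = k (β, s) (β', t)

namespace IsRewardModel

variable {ν : Measure Θ}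
  {k : (Fin d → ℝ) × ℕ → (Fin d → ℝ) × ℕ → ℝ} {D : Set (Fin d → ℝ)} {N : ℕ}
  {h : Θ → ℕ → D → ℝ}

theorem measurable_eval (H : IsRewardModel ν k D N h) (t : ℕ) (β : D) :
    Measurable fun θ => h θ t β :=
  (H.measurable t).comp measurable_prodMk_right

theorem memLp_eval (H : IsRewardModel ν k D N h) (t : ℕ) (β : D) :
    MemLp (fun θ => h θ t β) 2 ν :=
  (H.gaussian.hasGaussianLaw_eval (t, β)).memLp_two

/-- Measurability of the kernel is inherited from the process: as a covariance it is a parametric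
integral of a jointly measurable product. -/
theorem measurable_kernel [IsProbabilityMeasure ν] (H : IsRewardModel ν k D N h) {s t : ℕ} (hs : s ∈ Finset.Icc 1 N)
    (ht : t ∈ Finset.Icc 1 N) : Measurable fun p : D × D => k (p.1, s) (p.2, t) := by
  have hc : ∀ p : D × D, k (p.1, s) (p.2, t) = ∫ θ, h θ s p.1 * h θ t p.2 ∂ν := fun p => by
    rw [← H.covariance_eq s hs t ht, covariance, H.mean_zero, H.mean_zero]
    simp only [sub_zero]
  simp only [hc]
  have hm : Measurable fun q : (D × D) × Θ => h q.2 s q.1.1 * h q.2 t q.1.2 :=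
    ((H.measurable s).comp (measurable_snd.prodMk (measurable_fst.comp measurable_fst))).mul
      ((H.measurable t).comp (measurable_snd.prodMk (measurable_snd.comp measurable_fst)))
  exact (hm.stronglyMeasurable.integral_prod_right').measurable

theorem posSemidef_gram [IsProbabilityMeasure ν] (H : IsRewardModel ν k D N h) {n : ℕ} (x : Fin n → (Fin d → ℝ) × ℕ)
    (hx : ∀ i, (x i).1 ∈ D ∧ (x i).2 ∈ Finset.Icc 1 N) : (gram k x).PosSemidef :=
  posSemidef_of_covariance (ν := ν) (X := fun i θ => h θ (x i).2 ⟨(x i).1, (hx i).1⟩)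
    (fun _ => H.memLp_eval _ _) fun i j =>
      H.covariance_eq _ (hx i).2 _ (hx j).2 _ _

theorem hasGaussianLaw_prodMk (H : IsRewardModel ν k D N h) {n : ℕ} (x : Fin n → ℕ × D)
    (p : ℕ × D) :
    HasGaussianLaw (fun θ => ((fun i => h θ (x i).1 (x i).2), h θ p.1 p.2)) ν := by
  -- Indexing by `Option (Fin n)` instead of a set of points allows repetitions, also between `p`
  -- and the design.
  let idx : Option (Fin n) → ℕ × D := fun o => o.elim p x
  let L : ({o // o ∈ (Finset.univ : Finset (Option (Fin n)))} → ℝ) →L[ℝ] (Fin n → ℝ) × ℝ :=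
    ContinuousLinearMap.prod
      (ContinuousLinearMap.pi fun i => ContinuousLinearMap.proj ⟨some i, Finset.mem_univ _⟩)
      (ContinuousLinearMap.proj ⟨none, Finset.mem_univ _⟩)
  exact ((H.gaussian.comp_right idx).hasGaussianLaw Finset.univ).map_fun L

/-- Posterior concentration at the arm `β y` chosen after adaptively generated observations `y`. -/
theorem measure_posterior_le [IsProbabilityMeasure ν] (H : IsRewardModel ν k D N h)
    {φ : (n : ℕ) → (Fin n → ℝ) → (Fin d → ℝ)} (hφm : ∀ n, Measurable (φ n))
    (hφD : ∀ n y, φ n y ∈ D) {v : ℝ≥0} (hv : v ≠ 0) {n : ℕ} (hn : n < N)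
    {β : (Fin n → ℝ) → D} (hβ : Measurable β) {U : (Fin n → ℝ) → Set ℝ} (hU : ∀ y, IsOpen (U y))
    (hUm : MeasurableSet {p : ℝ × (Fin n → ℝ) | p.1 ∈ U p.2}) {q : ℝ≥0∞}
    (hq : ∀ y, gaussianReal 0 (posteriorVar k v (visited φ n y) (β y, n + 1)).toNNReal (U y) ≤ q) :
    (ν.prod (Measure.pi fun _ => gaussianReal 0 v))
      {p | h p.1 (n + 1) (β (respond (fun n y => h p.1 (n + 1) ⟨φ n y, hφD n y⟩) n p.2)) -
        posteriorMean k v (visited φ n (respond (fun n y => h p.1 (n + 1) ⟨φ n y, hφD n y⟩) n p.2))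
          (respond (fun n y => h p.1 (n + 1) ⟨φ n y, hφD n y⟩) n p.2)
          (β (respond (fun n y => h p.1 (n + 1) ⟨φ n y, hφD n y⟩) n p.2), n + 1) ∈
        U (respond (fun n y => h p.1 (n + 1) ⟨φ n y, hφD n y⟩) n p.2)} ≤ q := by
  have hn1 : n + 1 ∈ Finset.Icc 1 N := Finset.mem_Icc.2 ⟨by omega, by omega⟩
  have hi1 : ∀ i : Fin n, (i : ℕ) + 1 ∈ Finset.Icc 1 N := fun i =>
    Finset.mem_Icc.2 ⟨by omega, by have := i.is_lt; omega⟩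
  have hφ' : ∀ n, Measurable fun y => (⟨φ n y, hφD n y⟩ : D) := fun n => (hφm n).subtype_mk
  have hxm : ∀ i : Fin n, Measurable fun y : Fin n → ℝ =>
      (⟨φ i (past y i), hφD _ _⟩ : D) := fun i => (hφ' i).comp (measurable_past i)
  have hKm : ∀ i j : Fin n, Measurable fun y : Fin n → ℝ =>
      k (visited φ n y i) (visited φ n y j) := fun i j =>
    (H.measurable_kernel (hi1 i) (hi1 j)).comp ((hxm i).prodMk (hxm j))
  have hkm : ∀ i : Fin n, Measurable fun y : Fin n → ℝ =>
      k (visited φ n y i) (β y, n + 1) := fun i =>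
    (H.measurable_kernel (hi1 i) hn1).comp ((hxm i).prodMk hβ)
  have hμ : Measurable fun y : Fin n → ℝ =>
      posteriorMean k v (visited φ n y) y (β y, n + 1) :=
    measurable_posteriorMean measurable_id hKm hkm
  have hW : MeasurableSet {p : Θ × (Fin n → ℝ) | h p.1 (n + 1) (β p.2) -
      posteriorMean k v (visited φ n p.2) p.2 (β p.2, n + 1) ∈ U p.2} :=
    hUm.preimage ((((H.measurable (n + 1)).comp
      (measurable_fst.prodMk (hβ.comp measurable_snd))).sub (hμ.comp measurable_snd)).prodMk
        measurable_snd)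
  refine measure_respond_le (m := fun θ n y => h θ (n + 1) ⟨φ n y, hφD n y⟩) hv
    (fun i _ => (H.measurable (i + 1)).comp
      (measurable_fst.prodMk ((hφ' i).comp measurable_snd))) hW fun y => ?_
  have hps : (gram k (visited φ n y)).PosSemidef :=
    H.posSemidef_gram _ fun i => ⟨hφD _ _, hi1 i⟩
  have hdet := (posDef_add_smul_one hps (NNReal.coe_pos.2 (pos_iff_ne_zero.2 hv))).isUnit
  -- With `y` frozen the visited arms are deterministic, so the fixed-design bound applies. It must
  -- hold at this very `y`, since the design was built from it.
  have key := lintegral_posterior_le (ν := ν)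
    (X := fun (i : Fin n) θ => h θ (i + 1) ⟨φ i (past y i), hφD _ _⟩)
    (F := fun θ => h θ (n + 1) (β y)) (fun i => H.measurable_eval _ _) (H.measurable_eval _ _)
    (H.hasGaussianLaw_prodMk (fun i => ((i : ℕ) + 1, ⟨φ i (past y i), hφD _ _⟩)) (n + 1, β y))
    (fun i => H.mean_zero _ _) (H.mean_zero _ _) hv (K := gram k (visited φ n y))
    (k := kernelVec k (visited φ n y) (β y, n + 1))
    (a := (gram k (visited φ n y) + (v : ℝ) • (1 : Matrix (Fin n) (Fin n) ℝ))⁻¹ *ᵥ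
      kernelVec k (visited φ n y) (β y, n + 1))
    (fun i j => H.covariance_eq _ (hi1 i) _ (hi1 j) _ _)
    (fun i => H.covariance_eq _ (hi1 i) _ hn1 _ _)
    (H.covariance_eq _ hn1 _ hn1 _ _)
    (by rw [mulVec_mulVec, mul_nonsing_inv _ ((isUnit_iff_isUnit_det _).1 hdet), one_mulVec])
    (hU y) y
  refine le_trans (le_of_eq ?_) (key.trans (mul_le_mul_left (hq y) _))
  refine lintegral_congr fun θ => ?_
  congr 1
  rw [← posteriorMean_eq_sum (NNReal.coe_pos.2 (pos_iff_ne_zero.2 hv)) hps]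
  rfl

end IsRewardModel

end TVGP

/-! ### Transfer to the space of continuous paths, and confidence bounds -/

namespace TVGP

variable {d : ℕ}

namespace IsRewardModel

variable {Θ : Type*} [MeasurableSpace Θ] {ν : Measure Θ}
  {k : (Fin d → ℝ) × ℕ → (Fin d → ℝ) × ℕ → ℝ} {D : Set (Fin d → ℝ)} {N : ℕ}
  {h : Θ → ℕ → D → ℝ}

theorem measurable_posteriorVar_visited [IsProbabilityMeasure ν] (H : IsRewardModel ν k D N h)
    {φ : (n : ℕ) → (Fin n → ℝ) → (Fin d → ℝ)} (hφm : ∀ n, Measurable (φ n))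
    (hφD : ∀ n y, φ n y ∈ D) {v : ℝ} {n : ℕ} (hn : n < N)
    {β : (Fin n → ℝ) → D} (hβ : Measurable β) :
    Measurable fun y : Fin n → ℝ => posteriorVar k v (visited φ n y) (β y, n + 1) := by
  have hn1 : n + 1 ∈ Finset.Icc 1 N := Finset.mem_Icc.2 ⟨by omega, by omega⟩
  have hi1 : ∀ i : Fin n, (i : ℕ) + 1 ∈ Finset.Icc 1 N := fun i =>
    Finset.mem_Icc.2 ⟨by omega, by have := i.is_lt; omega⟩
  have hxm : ∀ i : Fin n, Measurable fun y : Fin n → ℝ =>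
      (⟨φ i (past y i), hφD _ _⟩ : D) := fun i =>
    ((hφm i).subtype_mk (h := hφD i)).comp (measurable_past i)
  exact measurable_posteriorVar
    (fun i j => (H.measurable_kernel (hi1 i) (hi1 j)).comp ((hxm i).prodMk (hxm j)))
    (fun i => (H.measurable_kernel (hi1 i) hn1).comp ((hxm i).prodMk hβ))
    ((H.measurable_kernel hn1 hn1).comp (hβ.prodMk hβ))

end IsRewardModel

/-- Families of continuous reward functions on `D`. -/
abbrev RewardPath (D : Set (Fin d → ℝ)) : Type :=
  {h : ℕ → D → ℝ // ∀ t, Continuous (h t)}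

/-- Carathéodory: continuity in the arm and measurability in the path give joint measurability. This
is the reason for passing to path space. -/
theorem measurable_rewardPath_eval {D : Set (Fin d → ℝ)} (t : ℕ) :
    Measurable fun p : RewardPath D × D => p.1.1 t p.2 := by
  have := measurable_uncurry_of_continuous_of_measurable
    (u := fun (β : D) (θ : RewardPath D) => θ.1 t β) (fun θ => θ.2 t) fun β =>
      (measurable_pi_apply β).comp ((measurable_pi_apply t).comp measurable_subtype_coe)
  exact this.comp measurable_swap

/-- Matches the two recursions; entry `i` of the noise vector belongs to round `i + 1`. -/
theorem respond_eq_observed {φ : (n : ℕ) → (Fin n → ℝ) → (Fin d → ℝ)} {D : Set (Fin d → ℝ)}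
    (hφD : ∀ n y, φ n y ∈ D) {g : ℕ → (Fin d → ℝ) → ℝ} {h : ℕ → D → ℝ} {N : ℕ}
    (hgh : ∀ t ∈ Finset.Icc 1 N, ∀ β : D, h t β = g t β) (e : ℕ → ℝ) :
    ∀ n ≤ N, respond (fun n y => h (n + 1) ⟨φ n y, hφD n y⟩) n (fun i => e (i + 1)) =
      fun i : Fin n => observed φ g e i
  | 0, _ => funext fun i => i.elim0
  | n + 1, hn => by
    have ih := respond_eq_observed hφD hgh e n (by omega)
    have hinit : (Fin.init (fun i : Fin (n + 1) => e (i + 1)) : Fin n → ℝ) =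
        fun i : Fin n => e (i + 1) := rfl
    funext i
    rw [respond, hinit, ih]
    refine Fin.lastCases ?_ (fun j => ?_) i
    · rw [Fin.snoc_last, hgh _ (Finset.mem_Icc.2 ⟨by omega, hn⟩), Fin.val_last, observed]
    · rw [Fin.snoc_castSucc]
      rfl

section Transfer

variable {Ω : Type*} {D : Set (Fin d → ℝ)} {f : ℕ → Ω → (Fin d → ℝ) → ℝ} {N : ℕ}

open Classical in
/-- The reward functions of the rounds `1, …, N` on the event `A`, and zero elsewhere. -/
noncomputable def truncatedReward (f : ℕ → Ω → (Fin d → ℝ) → ℝ) (D : Set (Fin d → ℝ)) (N : ℕ)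
    (A : Set Ω) (z : Ω) (t : ℕ) (β : D) : ℝ :=
  if t ∈ Finset.Icc 1 N ∧ z ∈ A then f t z β else 0

theorem truncatedReward_of_mem {A : Set Ω} {z : Ω} (hz : z ∈ A) {t : ℕ}
    (ht : t ∈ Finset.Icc 1 N) (β : D) : truncatedReward f D N A z t β = f t z β :=
  if_pos ⟨ht, hz⟩

theorem continuous_truncatedReward {A : Set Ω}
    (hA : ∀ z ∈ A, ∀ t ∈ Finset.Icc 1 N, ContinuousOn (f t z) D) (z : Ω) (t : ℕ) :
    Continuous (truncatedReward f D N A z t) := by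
  by_cases h : t ∈ Finset.Icc 1 N ∧ z ∈ A
  · have : truncatedReward f D N A z t = D.domRestrict (f t z) := funext fun β => if_pos h
    rw [this]
    exact (hA z h.2 t h.1).domRestrict
  · have : truncatedReward f D N A z t = fun _ => 0 := funext fun β => if_neg h
    rw [this]
    exact continuous_const

/-- The truncated reward functions as a random path. -/
noncomputable def rewardPath {A : Set Ω}
    (hA : ∀ z ∈ A, ∀ t ∈ Finset.Icc 1 N, ContinuousOn (f t z) D) (z : Ω) : RewardPath D :=
  ⟨truncatedReward f D N A z, continuous_truncatedReward hA z⟩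

variable [MeasurableSpace Ω] {P : Measure Ω}
  {A : Set Ω} (hA : ∀ z ∈ A, ∀ t ∈ Finset.Icc 1 N, ContinuousOn (f t z) D)

theorem measurable_rewardPath (hAm : MeasurableSet A)
    (hfm : ∀ t, ∀ β ∈ D, Measurable fun z => f t z β) : Measurable (rewardPath hA) := by
  refine Measurable.subtype_mk (measurable_pi_iff.2 fun t => measurable_pi_iff.2 fun β => ?_)
  by_cases ht : t ∈ Finset.Icc 1 N
  · have : (fun z => truncatedReward f D N A z t β) = A.indicator fun z => f t z β := by
      funext z
      by_cases hz : z ∈ A <;> simp [truncatedReward, ht, hz]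
    rw [this]
    exact (hfm t β β.2).indicator hAm
  · have : (fun z => truncatedReward f D N A z t β) = fun _ => 0 := by
      funext z
      simp only [truncatedReward, ht, false_and, if_false]
    rw [this]
    exact measurable_const

theorem isRewardModel_map_rewardPath {k : (Fin d → ℝ) × ℕ → (Fin d → ℝ) × ℕ → ℝ}
    (hf : IsCenteredGP P k D f) (hAm : MeasurableSet A) (hA1 : ∀ᵐ z ∂P, z ∈ A) :
    IsRewardModel (P.map (rewardPath hA)) k D N fun θ => θ.1 := by
  have hm := measurable_rewardPath hA hAm hf.measurable
  have hev : ∀ t (β : D), Measurable fun θ : RewardPath D => θ.1 t β := fun t β =>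
    (measurable_rewardPath_eval t).comp measurable_prodMk_right
  have hae : ∀ t ∈ Finset.Icc 1 N, ∀ β : D,
      (fun z => (rewardPath hA z).1 t β) =ᵐ[P] fun z => f t z β := fun t ht β =>
    hA1.mono fun z hz => truncatedReward_of_mem hz ht β
  have hzero : ∀ t, t ∉ Finset.Icc 1 N → ∀ (β : D) z, (rewardPath hA z).1 t β = 0 :=
    fun t ht β z => if_neg fun h => ht h.1
  refine ⟨measurable_rewardPath_eval, ⟨fun I => ⟨?_⟩⟩, fun t β => ?_, fun s hs t ht β β' => ?_⟩
  -- Up to almost sure equality, truncation multiplies each coordinate by a constant 0 or 1, which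
  -- keeps the process Gaussian.
  · have hg := hf.gaussian.smul fun p => if p.1 ∈ Finset.Icc 1 N then 1 else 0
    have hg' : IsGaussianProcess (fun (p : ℕ × D) z => (rewardPath hA z).1 p.1 p.2) P := by
      refine hg.congr fun p => ?_
      by_cases hp : p.1 ∈ Finset.Icc 1 N
      · filter_upwards [hae p.1 hp p.2] with z hz
        rw [hz, if_pos hp, one_smul]
      · refine Filter.Eventually.of_forall fun z => ?_
        simp only [hzero p.1 hp, if_neg hp, zero_smul]
    have := (hg'.hasGaussianLaw I).isGaussian_map
    rw [Measure.map_map ?_ hm]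
    · exact this
    · exact measurable_pi_iff.2 fun p => hev _ _
  · rw [integral_map hm.aemeasurable (hev t β).aestronglyMeasurable]
    by_cases ht : t ∈ Finset.Icc 1 N
    · rw [integral_congr_ae (hae t ht β), hf.mean_zero t β β.2]
    · simp only [hzero t ht, integral_zero]
  · rw [covariance_map_fun (hev s β).aestronglyMeasurable (hev t β').aestronglyMeasurable
      hm.aemeasurable, ← hf.covariance_eq s t β β.2 β' β'.2]
    rw [covariance, covariance, integral_congr_ae (hae s hs β), integral_congr_ae (hae t ht β')]
    refine integral_congr_ae ?_
    filter_upwards [hae s hs β, hae t ht β'] with z h1 h2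
    rw [h1, h2]

theorem map_rewardPath_prodMk_noise [IsProbabilityMeasure P] {v : ℝ≥0} {k : (Fin d → ℝ) × ℕ → (Fin d → ℝ) × ℕ → ℝ}
    {ε : ℕ → Ω → ℝ} (hf : IsCenteredGP P k D f) (hε : IsNoise P v D f ε)
    (hAm : MeasurableSet A) (hA1 : ∀ᵐ z ∂P, z ∈ A) (n : ℕ) :
    P.map (fun z => (rewardPath hA z, fun i : Fin n => ε (i + 1) z)) =
      (P.map (rewardPath hA)).prod (Measure.pi fun _ => gaussianReal 0 v) := by
  have hm := measurable_rewardPath hA hAm hf.measurable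
  have hεm : Measurable fun z (i : Fin n) => ε (i + 1) z :=
    measurable_pi_iff.2 fun i => hε.measurable _
  have hlaw : P.map (fun z (i : Fin n) => ε (i + 1) z) = Measure.pi fun _ => gaussianReal 0 v := by
    have hinj : Function.Injective fun i : Fin n => (i : ℕ) + 1 := fun i j hij =>
      Fin.ext (Nat.succ_injective hij)
    have := (iIndepFun_iff_map_fun_eq_pi_map fun i : Fin n => (hε.measurable (i + 1)).aemeasurable).1
      (hε.iIndep.precomp hinj)
    rw [this]
    simp only [hε.law]
  have hind : IndepFun (rewardPath hA) (fun z (i : Fin n) => ε (i + 1) z) P := by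
    -- Almost surely the path is this measurable function of the whole reward process, so it
    -- inherits independence from the noise.
    let a : (ℕ × D → ℝ) → ℕ → D → ℝ := fun g t β => if t ∈ Finset.Icc 1 N then g (t, β) else 0
    have ham : Measurable a := by
      refine measurable_pi_iff.2 fun t => measurable_pi_iff.2 fun β => ?_
      by_cases ht : t ∈ Finset.Icc 1 N
      · simp only [a, if_pos ht]
        exact measurable_pi_apply _
      · simp only [a, if_neg ht]
        exact measurable_const
    have h1 := hε.indep_reward.comp (φ := a) (ψ := fun e (i : Fin n) => e ((i : ℕ) + 1)) ham
      (measurable_pi_iff.2 fun i => measurable_pi_apply _)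
    have h2 : IndepFun (Subtype.val ∘ rewardPath hA) (fun z (i : Fin n) => ε (i + 1) z) P := by
      refine h1.congr (hA1.mono fun z hz => ?_) (Filter.EventuallyEq.refl _ _)
      funext t β
      by_cases ht : t ∈ Finset.Icc 1 N
      · simp only [Function.comp_apply, a, if_pos ht]
        exact (truncatedReward_of_mem hz ht β).symm
      · simp only [Function.comp_apply, a, if_neg ht]
        exact (if_neg fun h => ht h.1).symm
    rw [IndepFun_iff_Indep] at h2 ⊢
    rwa [← MeasurableSpace.comap_comp] at h2
  rw [(indepFun_iff_map_prod_eq_prod_map_map hm.aemeasurable hεm.aemeasurable).1 hind, hlaw]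

/-- The rewards observed in the first `n` rounds. -/
noncomputable def observations (φ : (n : ℕ) → (Fin n → ℝ) → (Fin d → ℝ))
    (f : ℕ → Ω → (Fin d → ℝ) → ℝ) (ε : ℕ → Ω → ℝ) (n : ℕ) (z : Ω) : Fin n → ℝ :=
  fun i => observed φ (fun t => f t z) (fun t => ε t z) i

section Concentration

variable {v : ℝ≥0} {k : (Fin d → ℝ) × ℕ → (Fin d → ℝ) × ℕ → ℝ} {ε : ℕ → Ω → ℝ}
  {φ : (n : ℕ) → (Fin n → ℝ) → (Fin d → ℝ)} {n : ℕ} {β : (Fin n → ℝ) → D}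

/-- The set of outcomes with continuous rewards need not be measurable, so it is replaced by a
measurable subset of full measure. -/
theorem exists_continuity_event
    (hcont : ∀ t ∈ Finset.Icc 1 N, ∀ᵐ z ∂P, ContinuousOn (f t z) D) :
    ∃ A : Set Ω, MeasurableSet A ∧ (∀ᵐ z ∂P, z ∈ A) ∧
      ∀ z ∈ A, ∀ t ∈ Finset.Icc 1 N, ContinuousOn (f t z) D := by
  have h0 : ∀ᵐ z ∂P, ∀ t ∈ Finset.Icc 1 N, ContinuousOn (f t z) D :=
    (ae_ball_iff (Finset.countable_toSet _)).2 hcont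
  obtain ⟨s, hs, hsm, hs0⟩ := exists_measurable_superset_of_null (ae_iff.1 h0)
  refine ⟨sᶜ, hsm.compl, compl_mem_ae_iff.2 hs0, fun z hz => ?_⟩
  by_contra hbad
  exact hz (hs hbad)

theorem sqrt_toNNReal (x : ℝ) : Real.sqrt (x.toNNReal : ℝ) = Real.sqrt x := by
  rcases le_total 0 x with h | h
  · rw [Real.coe_toNNReal _ h]
  · rw [Real.toNNReal_of_nonpos h, Real.sqrt_eq_zero_of_nonpos h, NNReal.coe_zero, Real.sqrt_zero]

/-- Concentration of the process around the posterior mean after adaptively chosen observations. -/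
theorem measure_posterior_sub_mem_le [IsProbabilityMeasure P] (hf : IsCenteredGP P k D f) (hε : IsNoise P v D f ε)
    (hcont : ∀ t ∈ Finset.Icc 1 N, ∀ᵐ z ∂P, ContinuousOn (f t z) D)
    (hφm : ∀ n, Measurable (φ n)) (hφD : ∀ n y, φ n y ∈ D) (hv : v ≠ 0) (hn : n < N)
    (hβ : Measurable β) {U : ℝ → Set ℝ} (hU : ∀ s, IsOpen (U s))
    (hUm : MeasurableSet {p : ℝ × ℝ | p.1 ∈ U p.2}) {q : ℝ≥0∞}
    (hq : ∀ s : ℝ≥0, gaussianReal 0 s (U (Real.sqrt s)) ≤ q) :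
    P {z | f (n + 1) z (β (observations φ f ε n z)) -
      posteriorMean k v (visited φ n (observations φ f ε n z)) (observations φ f ε n z)
        (β (observations φ f ε n z), n + 1) ∈
      U (Real.sqrt (posteriorVar k v (visited φ n (observations φ f ε n z))
        (β (observations φ f ε n z), n + 1)))} ≤ q := by
  obtain ⟨A, hAm, hA1, hA⟩ := exists_continuity_event hcont
  have hm := measurable_rewardPath hA hAm hf.measurable
  have hεm : Measurable fun z (i : Fin n) => ε (i + 1) z :=
    measurable_pi_iff.2 fun i => hε.measurable _
  have H := isRewardModel_map_rewardPath hA hf hAm hA1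
  have hprob : IsProbabilityMeasure (P.map (rewardPath hA)) :=
    Measure.isProbabilityMeasure_map hm.aemeasurable
  have hvar := H.measurable_posteriorVar_visited hφm hφD (v := v) hn hβ
  have key := H.measure_posterior_le hφm hφD hv hn hβ
    (U := fun y => U (Real.sqrt (posteriorVar k v (visited φ n y) (β y, n + 1))))
    (fun y => hU _)
    (hUm.preimage (measurable_fst.prodMk ((hvar.comp measurable_snd).sqrt)))
    (q := q) fun y => by
      have := hq (posteriorVar k v (visited φ n y) (β y, n + 1)).toNNReal
      rwa [sqrt_toNNReal] at this
  rw [← map_rewardPath_prodMk_noise hA hf hε hAm hA1 n] at key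
  -- This direction of the image measure inequality needs no measurability of the event.
  refine le_trans ?_ ((Measure.le_map_apply (hm.prodMk hεm).aemeasurable _).trans key)
  refine measure_mono_ae (hA1.mono fun z hz hbad => ?_)
  have hobs : respond (fun n y => (rewardPath hA z).1 (n + 1) ⟨φ n y, hφD n y⟩) n
      (fun i : Fin n => ε (i + 1) z) = observations φ f ε n z :=
    respond_eq_observed hφD (g := fun t => f t z)
      (fun t ht β => truncatedReward_of_mem hz ht β) (fun t => ε t z) n hn.le
  have hval : ∀ β : D, (rewardPath hA z).1 (n + 1) β = f (n + 1) z β := fun β =>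
    truncatedReward_of_mem hz (Finset.mem_Icc.2 ⟨by omega, by omega⟩) β
  refine Set.mem_preimage.2 ?_
  simp only [hobs, hval]
  exact hbad

theorem measure_upper_deviation_le [IsProbabilityMeasure P] (hf : IsCenteredGP P k D f) (hε : IsNoise P v D f ε)
    (hcont : ∀ t ∈ Finset.Icc 1 N, ∀ᵐ z ∂P, ContinuousOn (f t z) D)
    (hφm : ∀ n, Measurable (φ n)) (hφD : ∀ n y, φ n y ∈ D) (hv : v ≠ 0) (hn : n < N)
    (hβ : Measurable β) {c : ℝ} (hc : 0 ≤ c) :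
    P {z | posteriorMean k v (visited φ n (observations φ f ε n z)) (observations φ f ε n z)
        (β (observations φ f ε n z), n + 1) +
      c * Real.sqrt (posteriorVar k v (visited φ n (observations φ f ε n z))
        (β (observations φ f ε n z), n + 1)) < f (n + 1) z (β (observations φ f ε n z))} ≤
      ENNReal.ofReal (Real.exp (-(c ^ 2 / 2))) := by
  refine le_trans (measure_mono fun z hz => ?_) (measure_posterior_sub_mem_le hf hε hcont hφm hφD
    hv hn hβ (U := fun s => Set.Ioi (c * s)) (fun s => isOpen_Ioi)
    (measurableSet_lt (measurable_snd.const_mul c) measurable_fst)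
    fun s => gaussianReal_Ioi_le s hc)
  simp only [Set.mem_ofPred_eq, Set.mem_Ioi] at hz ⊢
  linarith

theorem measure_lower_deviation_le [IsProbabilityMeasure P] (hf : IsCenteredGP P k D f) (hε : IsNoise P v D f ε)
    (hcont : ∀ t ∈ Finset.Icc 1 N, ∀ᵐ z ∂P, ContinuousOn (f t z) D)
    (hφm : ∀ n, Measurable (φ n)) (hφD : ∀ n y, φ n y ∈ D) (hv : v ≠ 0) (hn : n < N)
    (hβ : Measurable β) {c : ℝ} (hc : 0 ≤ c) :
    P {z | f (n + 1) z (β (observations φ f ε n z)) <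
      posteriorMean k v (visited φ n (observations φ f ε n z)) (observations φ f ε n z)
        (β (observations φ f ε n z), n + 1) -
      c * Real.sqrt (posteriorVar k v (visited φ n (observations φ f ε n z))
        (β (observations φ f ε n z), n + 1))} ≤
      ENNReal.ofReal (Real.exp (-(c ^ 2 / 2))) := by
  refine le_trans (measure_mono fun z hz => ?_) (measure_posterior_sub_mem_le hf hε hcont hφm hφD
    hv hn hβ (U := fun s => Set.Iio (-(c * s))) (fun s => isOpen_Iio)
    (measurableSet_lt measurable_fst (measurable_snd.const_mul c).neg)
    fun s => gaussianReal_Iio_le s hc)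
  simp only [Set.mem_ofPred_eq, Set.mem_Iio] at hz ⊢
  linarith

end Concentration

end Transfer

end TVGP

/-! ### Information gain and posterior variances -/

namespace TVGP

section InformationGain

variable {I : Type*} {k : I → I → ℝ} {v : ℝ} {x : ℕ → I}

theorem gram_succ_submatrix (x : ℕ → I) (n : ℕ)
    (hsymm : ∀ i < n, k (x n) (x i) = k (x i) (x n)) :
    (gram k fun i : Fin (n + 1) => x i).submatrix finSumFinEquiv finSumFinEquiv =
      fromBlocks (gram k fun i : Fin n => x i)
        (replicateCol (Fin 1) (kernelVec k (fun i : Fin n => x i) (x n)))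
        (replicateCol (Fin 1) (kernelVec k (fun i : Fin n => x i) (x n)))ᴴ
        (of fun _ _ => k (x n) (x n)) := by
  ext i j
  rcases i with i | i <;> rcases j with j | j
  · simp [gram]
  · simp [gram, kernelVec]
  · simp [gram, kernelVec, hsymm]
  · simp [gram]

theorem gram_symm {n : ℕ} {x : Fin n → I} (h : (gram k x).PosSemidef) (i j : Fin n) :
    k (x i) (x j) = k (x j) (x i) := by
  have := congrFun (congrFun h.isHermitian j) i
  simpa [gram] using this

theorem gram_castSucc_posSemidef {n : ℕ}
    (h : (gram k fun i : Fin (n + 1) => x i).PosSemidef) :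
    (gram k fun i : Fin n => x i).PosSemidef :=
  h.submatrix Fin.castSucc

theorem schur_complement_apply (x : ℕ → I) (n : ℕ) (A : Matrix (Fin n) (Fin n) ℝ) :
    ((replicateCol (Fin 1) (kernelVec k (fun i : Fin n => x i) (x n)))ᴴ * A *
      replicateCol (Fin 1) (kernelVec k (fun i : Fin n => x i) (x n))) 0 0 =
      kernelVec k (fun i : Fin n => x i) (x n) ⬝ᵥ
        (A *ᵥ kernelVec k (fun i : Fin n => x i) (x n)) := by
  rw [Matrix.mul_assoc]
  simp [Matrix.mul_apply, dotProduct, mulVec]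

/-- Adding `v` to the first `n` diagonal entries only keeps the Gram matrix of `n + 1` points
positive semidefinite; the posterior variance is then the Schur complement of the leading block. -/
theorem posteriorVar_nonneg (hv : 0 < v) (n : ℕ)
    (h : (gram k fun i : Fin (n + 1) => x i).PosSemidef) :
    0 ≤ posteriorVar k v (fun i : Fin n => x i) (x n) := by
  have hsymm : ∀ i < n, k (x n) (x i) = k (x i) (x n) := fun i hi =>
    gram_symm h (Fin.last n) ⟨i, by omega⟩
  have hA := posDef_add_smul_one (gram_castSucc_posSemidef h) hv
  have h1 := h.submatrix finSumFinEquiv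
  rw [gram_succ_submatrix x n hsymm] at h1
  have h2 : (fromBlocks (v • (1 : Matrix (Fin n) (Fin n) ℝ)) 0 0
      (0 : Matrix (Fin 1) (Fin 1) ℝ)).PosSemidef := by
    have : fromBlocks (v • (1 : Matrix (Fin n) (Fin n) ℝ)) 0 0 (0 : Matrix (Fin 1) (Fin 1) ℝ) =
        diagonal (Sum.elim (fun _ => v) fun _ => 0) := by
      ext i j
      rcases i with i | i <;> rcases j with j | j <;> simp [diagonal_apply, Matrix.one_apply]
    rw [this]
    refine PosSemidef.diagonal fun i => ?_
    rcases i with i | i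
    · exact hv.le
    · exact le_rfl
  have h3 := h1.add h2
  rw [fromBlocks_add, add_zero, add_zero, add_zero] at h3
  have := hA.isUnit.invertible
  have h4 := ((PosDef.fromBlocks₁₁ _ _ hA).1 h3).diag_nonneg (i := 0)
  rw [Matrix.sub_apply, schur_complement_apply] at h4
  exact h4

theorem posteriorVar_le (hv : 0 < v) {n : ℕ} {x : Fin n → I} (h : (gram k x).PosSemidef) (p : I) :
    posteriorVar k v x p ≤ k p p := by
  have h1 := (posDef_add_smul_one h hv).inv.posSemidef.dotProduct_mulVec_nonneg (kernelVec k x p)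
  rw [star_trivial] at h1
  exact sub_le_self _ h1

/-- With `v` added to the whole diagonal, the Schur complement of the leading block is `v` plus the
posterior variance; the rest is scaling by `v⁻¹`. -/
theorem det_gram_succ (hv : 0 < v) (n : ℕ) (h : (gram k fun i : Fin (n + 1) => x i).PosSemidef) :
    (1 + v⁻¹ • gram k fun i : Fin (n + 1) => x i).det =
      (1 + v⁻¹ • gram k fun i : Fin n => x i).det *
        (1 + v⁻¹ * posteriorVar k v (fun i : Fin n => x i) (x n)) := by
  have hsymm : ∀ i < n, k (x n) (x i) = k (x i) (x n) := fun i hi =>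
    gram_symm h (Fin.last n) ⟨i, by omega⟩
  have hscale : ∀ (m : ℕ) (K : Matrix (Fin m) (Fin m) ℝ),
      (1 + v⁻¹ • K).det = v⁻¹ ^ m * (K + v • 1).det := fun m K => by
    have : 1 + v⁻¹ • K = v⁻¹ • (K + v • (1 : Matrix (Fin m) (Fin m) ℝ)) := by
      rw [smul_add, smul_smul, inv_mul_cancel₀ hv.ne', one_smul, add_comm]
    rw [this, det_smul, Fintype.card_fin]
  have hA := posDef_add_smul_one (gram_castSucc_posSemidef h) hv
  have := hA.isUnit.invertible
  have hdet : ((gram k fun i : Fin (n + 1) => x i) + v • 1).det =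
      ((gram k fun i : Fin n => x i) + v • 1).det *
        (v + posteriorVar k v (fun i : Fin n => x i) (x n)) := by
    rw [← det_submatrix_equiv_self finSumFinEquiv, submatrix_add, Pi.add_apply, Pi.add_apply,
      gram_succ_submatrix x n hsymm, submatrix_smul, Pi.smul_apply, Pi.smul_apply,
      submatrix_one_equiv, ← fromBlocks_one, fromBlocks_smul, fromBlocks_add, smul_zero, smul_zero,
      add_zero, add_zero, det_fromBlocks₁₁, det_fin_one, Matrix.sub_apply, invOf_eq_nonsing_inv,
      schur_complement_apply]
    simp only [posteriorVar, Matrix.add_apply, of_apply, Matrix.smul_apply, one_apply_eq,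
      smul_eq_mul, mul_one]
    ring
  rw [hscale, hscale, hdet, pow_succ]
  field_simp

/-- Chain rule for the mutual information. -/
theorem infoGain_eq_sum (hv : 0 < v) (n : ℕ) (h : (gram k fun i : Fin n => x i).PosSemidef) :
    infoGain k v (fun i : Fin n => x i) =
      1 / 2 * ∑ i ∈ Finset.range n,
        Real.log (1 + v⁻¹ * posteriorVar k v (fun j : Fin i => x j) (x i)) := by
  induction n with
  | zero => simp [infoGain]
  | succ n ih =>
    have h' := gram_castSucc_posSemidef h
    have hvar := posteriorVar_nonneg hv n h
    have hpos : 0 < (1 + v⁻¹ • gram k fun i : Fin n => x i).det :=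
      (PosDef.one.add_posSemidef (h'.smul (inv_nonneg.2 hv.le))).det_pos
    have hpos' : 0 < 1 + v⁻¹ * posteriorVar k v (fun i : Fin n => x i) (x n) := by positivity
    rw [Finset.sum_range_succ, mul_add, ← ih h', infoGain, infoGain, det_gram_succ hv n h,
      Real.log_mul hpos.ne' hpos'.ne', mul_add]

/-- The chord of the concave logarithm over [1, 1 + u]. With u = σ_f⁻² and s a posterior variance,
it produces the denominator of C_1. -/
theorem mul_log_one_add_le {s u : ℝ} (hs0 : 0 ≤ s) (hs1 : s ≤ 1) (hu : 0 ≤ u) :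
    s * Real.log (1 + u) ≤ Real.log (1 + u * s) := by
  have h := strictConcaveOn_log_Ioi.concaveOn.2 (x := 1 + u) (y := 1)
    (Set.mem_Ioi.2 (by positivity)) (Set.mem_Ioi.2 one_pos) hs0 (sub_nonneg.2 hs1) (by ring)
  simp only [smul_eq_mul, Real.log_one, mul_zero, add_zero, mul_one] at h
  exact h.trans_eq (congrArg Real.log (by ring))

/-- The posterior variances along a sequence of points are controlled by the information gain. -/
theorem sum_posteriorVar_le (hv : 0 < v) (n : ℕ) (h : (gram k fun i : Fin n => x i).PosSemidef)
    (hk : ∀ i < n, k (x i) (x i) ≤ 1) :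
    (∑ i ∈ Finset.range n, posteriorVar k v (fun j : Fin i => x j) (x i)) * Real.log (1 + v⁻¹) ≤
      2 * infoGain k v (fun i : Fin n => x i) := by
  have hps : ∀ m ≤ n, (gram k fun i : Fin m => x i).PosSemidef := fun m hm =>
    h.submatrix (Fin.castLE hm)
  rw [infoGain_eq_sum hv n h, Finset.sum_mul]
  have : ∀ i ∈ Finset.range n, posteriorVar k v (fun j : Fin i => x j) (x i) *
      Real.log (1 + v⁻¹) ≤ Real.log (1 + v⁻¹ * posteriorVar k v (fun j : Fin i => x j) (x i)) :=
    fun i hi => by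
      have hi' := Finset.mem_range.1 hi
      exact mul_log_one_add_le (posteriorVar_nonneg hv i (hps _ hi'))
        ((posteriorVar_le hv (hps _ hi'.le) _).trans (hk i hi')) (inv_nonneg.2 hv.le)
  linarith [Finset.sum_le_sum this]

theorem infoGain_le (hv : 0 < v) (n : ℕ) (h : (gram k fun i : Fin n => x i).PosSemidef)
    (hk : ∀ i < n, k (x i) (x i) ≤ 1) :
    infoGain k v (fun i : Fin n => x i) ≤ 1 / 2 * (n * Real.log (1 + v⁻¹)) := by
  have hps : ∀ m ≤ n, (gram k fun i : Fin m => x i).PosSemidef := fun m hm =>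
    h.submatrix (Fin.castLE hm)
  rw [infoGain_eq_sum hv n h]
  refine mul_le_mul_of_nonneg_left ?_ (by norm_num)
  refine (Finset.sum_le_card_nsmul _ _ (Real.log (1 + v⁻¹)) fun i hi => ?_).trans_eq (by simp)
  have hi' := Finset.mem_range.1 hi
  have h0 := posteriorVar_nonneg hv i (hps _ hi')
  refine Real.log_le_log (by positivity) ?_
  have := (posteriorVar_le hv (hps _ hi'.le) (x i)).trans (hk i hi')
  have hv' := inv_pos.2 hv
  nlinarith

end InformationGain

end TVGP

/-! ### Nets in a compact convex set and Lipschitz bounds -/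

namespace TVGP

variable {d : ℕ}

/-- The Euclidean projection onto a compact convex set decreases distances to its points. -/
theorem exists_projection {D : Set (Fin d → ℝ)} (hne : D.Nonempty) (hc : IsCompact D)
    (hconv : Convex ℝ D) (c : Fin d → ℝ) :
    ∃ p ∈ D, ∀ x ∈ D, ∑ j, (x j - p j) ^ 2 ≤ ∑ j, (x j - c j) ^ 2 := by
  obtain ⟨p, hp, hmin⟩ := hc.exists_isMinOn hne
    (f := fun p : Fin d → ℝ => ∑ j, (c j - p j) ^ 2) (by fun_prop)
  refine ⟨p, hp, fun x hx => ?_⟩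
  set A := ∑ j, (c j - p j) * (x j - p j) with hA
  set B := ∑ j, (x j - p j) ^ 2 with hB
  have hB0 : 0 ≤ B := Finset.sum_nonneg fun j _ => sq_nonneg _
  have hquad : ∀ t : ℝ, ∑ j, (c j - (p j + t * (x j - p j))) ^ 2 =
      ∑ j, (c j - p j) ^ 2 - 2 * t * A + t ^ 2 * B := fun t => by
    rw [hA, hB, Finset.mul_sum, Finset.mul_sum, ← Finset.sum_sub_distrib, ← Finset.sum_add_distrib]
    exact Finset.sum_congr rfl fun j _ => by ring
  have hvar : ∀ t : ℝ, 0 < t → t ≤ 1 → 2 * A ≤ t * B := fun t ht0 ht1 => by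
    have hmem : p + t • (x - p) ∈ D := hconv.add_smul_sub_mem hp hx ⟨ht0.le, ht1⟩
    have h : ∑ j, (c j - p j) ^ 2 ≤ ∑ j, (c j - (p j + t * (x j - p j))) ^ 2 := hmin hmem
    rw [hquad] at h
    have : t * (2 * A) ≤ t * (t * B) := by linarith
    exact le_of_mul_le_mul_left this ht0
  have hA0 : A ≤ 0 := by
    by_contra! hpos
    have hAB : 0 < A + B := by linarith
    -- Instead of letting t tend to 0, one explicit value suffices: for A > 0 it gives 2A(A + B) ≤
    -- AB, which is absurd.
    have h := hvar (A / (A + B)) (div_pos hpos hAB) ((div_le_one hAB).2 (by linarith))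
    rw [div_mul_eq_mul_div, le_div_iff₀ hAB] at h
    nlinarith
  have hexp : ∑ j, (x j - c j) ^ 2 = B - 2 * A + ∑ j, (c j - p j) ^ 2 := by
    rw [hA, hB, Finset.mul_sum, ← Finset.sum_sub_distrib, ← Finset.sum_add_distrib]
    exact Finset.sum_congr rfl fun j _ => by ring
  have : 0 ≤ ∑ j, (c j - p j) ^ 2 := Finset.sum_nonneg fun j _ => sq_nonneg _
  linarith

/-- Every point of the unit interval is close to the midpoint of one of `m` cells. -/
theorem exists_midpoint {m : ℕ} (hm : 0 < m) {x : ℝ} (hx0 : 0 ≤ x) (hx1 : x ≤ 1) :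
    ∃ i : Fin m, |x - ((i : ℕ) + 1 / 2) / m| ≤ 1 / (2 * m) := by
  have hm' : (0 : ℝ) < m := Nat.cast_pos.2 hm
  have key : ∀ i : ℕ, (i : ℝ) ≤ m * x → m * x ≤ i + 1 →
      |x - ((i : ℕ) + 1 / 2) / m| ≤ 1 / (2 * m) := fun i h1 h2 => by
    have : x - ((i : ℕ) + 1 / 2) / m = (m * x - i - 1 / 2) / m := by field_simp; ring
    rw [this, abs_div, abs_of_pos hm', div_le_div_iff₀ hm' (by positivity)]
    have : |m * x - i - 1 / 2| ≤ 1 / 2 := abs_le.2 ⟨by linarith, by linarith⟩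
    nlinarith
  rcases lt_or_ge x 1 with h | h
  · have h0 : 0 ≤ m * x := by positivity
    refine ⟨⟨⌊m * x⌋₊, (Nat.floor_lt h0).2 (by nlinarith)⟩, ?_⟩
    exact key _ (Nat.floor_le h0) (Nat.lt_floor_add_one _).le
  · obtain rfl : x = 1 := le_antisymm hx1 h
    -- At x = 1 the floor of m x is m, one past the last cell.
    refine ⟨⟨m - 1, by omega⟩, key _ ?_ ?_⟩
    · rw [Nat.cast_sub hm]; simp
    · rw [Nat.cast_sub hm]; simp

/-- A compact convex subset of the unit cube has an `ℓ¹`-net of mesh `d / (2m)` with at most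
`m ^ d` points. -/
theorem exists_net {D : Set (Fin d → ℝ)} (hsub : D ⊆ Set.Icc 0 1) (hne : D.Nonempty)
    (hc : IsCompact D) (hconv : Convex ℝ D) {m : ℕ} (hm : 0 < m) :
    ∃ S : Finset (Fin d → ℝ), (∀ s ∈ S, s ∈ D) ∧ S.card ≤ m ^ d ∧
      ∀ x ∈ D, ∃ s ∈ S, ∑ j, |x j - s j| ≤ d / (2 * m) := by
  classical
  have hm' : (0 : ℝ) < m := Nat.cast_pos.2 hm
  -- Cell midpoints may lie outside `D`; projecting them moves them into `D` and no farther from its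
  -- points. The Euclidean error √d/(2m) becomes d/(2m) in ℓ¹ by Cauchy–Schwarz.
  choose p hpD hp using fun g : Fin d → Fin m =>
    exists_projection hne hc hconv fun j => ((g j : ℕ) + 1 / 2 : ℝ) / m
  refine ⟨Finset.univ.image p, fun s hs => ?_, ?_, fun x hx => ?_⟩
  · obtain ⟨g, -, rfl⟩ := Finset.mem_image.1 hs
    exact hpD g
  · refine Finset.card_image_le.trans ?_
    simp
  · have hx01 := hsub hx
    choose g hg using fun j => exists_midpoint hm (hx01.1 j) (hx01.2 j)
    refine ⟨p g, Finset.mem_image_of_mem _ (Finset.mem_univ _), ?_⟩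
    have h1 : ∑ j, (x j - p g j) ^ 2 ≤ d * (1 / (2 * m)) ^ 2 := by
      refine (hp g x hx).trans ?_
      have : ∀ j ∈ Finset.univ, (x j - ((g j : ℕ) + 1 / 2 : ℝ) / m) ^ 2 ≤ (1 / (2 * (m : ℝ))) ^ 2 :=
        fun j _ => sq_le_sq' (neg_le_of_abs_le (hg j)) (le_of_abs_le (hg j))
      simpa using Finset.sum_le_card_nsmul _ _ _ this
    have h2 : (∑ j, |x j - p g j|) ^ 2 ≤ d * ∑ j, (x j - p g j) ^ 2 := by
      simpa using sq_sum_le_card_mul_sum_sq (s := Finset.univ) (f := fun j => |x j - p g j|)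
    refine le_of_sq_le_sq ?_ (by positivity)
    calc _ ≤ (d : ℝ) * (d * (1 / (2 * m)) ^ 2) :=
          h2.trans (mul_le_mul_of_nonneg_left h1 (Nat.cast_nonneg d))
      _ = _ := by ring

theorem sub_le_of_gradient_bound {D : Set (Fin d → ℝ)} (hconv : Convex ℝ D)
    {h : (Fin d → ℝ) → ℝ} {g : (Fin d → ℝ) → Fin d → ℝ} (hg : HasContinuousGradientOn h g D)
    {L : ℝ} (hL : ∀ x ∈ D, ∀ j, |g x j| ≤ L) {x y : Fin d → ℝ} (hx : x ∈ D) (hy : y ∈ D) :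
    h x - h y ≤ L * ∑ j, |x j - y j| := by
  obtain ⟨z, hz, he⟩ := domain_mvt hg.2 hconv hy hx
  have hzD := hconv.segment_subset hy hx hz
  rw [he]
  simp only [_root_.sum_apply, _root_.smul_apply,
    ContinuousLinearMap.proj_apply, Pi.sub_apply, smul_eq_mul, Finset.mul_sum]
  refine Finset.sum_le_sum fun j _ => (le_abs_self _).trans ?_
  rw [abs_mul]
  exact mul_le_mul_of_nonneg_right (hL z hzD j) (abs_nonneg _)

theorem HasContinuousGradientOn.continuousOn {D : Set (Fin d → ℝ)} {h : (Fin d → ℝ) → ℝ}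
    {g : (Fin d → ℝ) → Fin d → ℝ} (hg : HasContinuousGradientOn h g D) : ContinuousOn h D :=
  fun x hx => (hg.2 x hx).continuousWithinAt

end TVGP

/-! ### Calibration of the exploration parameter -/

namespace TVGP

/-- The Lipschitz constant `b √(log(d a π² n² / (2δ)))` of the reward in round `n`. -/
noncomputable def lipschitzParam (d : ℕ) (a b δ : ℝ) (n : ℕ) : ℝ :=
  b * Real.sqrt (Real.log ((d : ℝ) * a * Real.pi ^ 2 * (n : ℝ) ^ 2 / (2 * δ)))

/-- The resolution `d n² L_n` of the discretization in round `n`. -/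
noncomputable def resolution (d : ℕ) (a b δ : ℝ) (n : ℕ) : ℝ :=
  (d : ℝ) * (n : ℝ) ^ 2 * lipschitzParam d a b δ n

section

variable {d : ℕ} {a b δ : ℝ} {n : ℕ}

theorem explorationParam_eq : explorationParam d a b δ n =
    2 * Real.log (Real.pi ^ 2 * (n : ℝ) ^ 2 / (2 * δ)) +
      2 * (d : ℝ) * Real.log (resolution d a b δ n) := by
  rw [explorationParam, resolution, lipschitzParam]
  congr 3
  ring

/-- Already π² > 9 exceeds 2δ, and the other factors are at least 1. -/
theorem one_lt_log_argument (hd : 1 ≤ d) (ha : 1 ≤ a) (hδ : δ ∈ Set.Ioo (0 : ℝ) 1) (hn : 1 ≤ n) :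
    1 < (d : ℝ) * a * Real.pi ^ 2 * (n : ℝ) ^ 2 / (2 * δ) := by
  have hd' : (1 : ℝ) ≤ d := Nat.one_le_cast.2 hd
  have hn' : (1 : ℝ) ≤ n := Nat.one_le_cast.2 hn
  have h1 : (1 : ℝ) ≤ d * a := one_le_mul_of_one_le_of_one_le hd' ha
  have h2 : (9 : ℝ) ≤ Real.pi ^ 2 := by nlinarith [Real.pi_gt_three]
  have h3 : (1 : ℝ) ≤ (n : ℝ) ^ 2 := one_le_pow₀ hn'
  have h4 : (9 : ℝ) ≤ d * a * Real.pi ^ 2 := by nlinarith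
  have h5 : (9 : ℝ) ≤ d * a * Real.pi ^ 2 * (n : ℝ) ^ 2 := by nlinarith
  rw [lt_div_iff₀ (by linarith [hδ.1])]
  linarith [hδ.2]

theorem lipschitzParam_pos (hd : 1 ≤ d) (ha : 1 ≤ a) (hb : 0 < b) (hδ : δ ∈ Set.Ioo (0 : ℝ) 1)
    (hn : 1 ≤ n) : 0 < lipschitzParam d a b δ n :=
  mul_pos hb (Real.sqrt_pos.2 (Real.log_pos (one_lt_log_argument hd ha hδ hn)))

theorem resolution_pos (hd : 1 ≤ d) (ha : 1 ≤ a) (hb : 0 < b) (hδ : δ ∈ Set.Ioo (0 : ℝ) 1)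
    (hn : 1 ≤ n) : 0 < resolution d a b δ n := by
  have hd' : (0 : ℝ) < d := Nat.cast_pos.2 hd
  have hn' : (0 : ℝ) < n := Nat.cast_pos.2 hn
  have := lipschitzParam_pos hd ha hb hδ hn
  rw [resolution]
  positivity

theorem explorationParam_mono (hd : 1 ≤ d) (ha : 1 ≤ a) (hb : 0 < b)
    (hδ : δ ∈ Set.Ioo (0 : ℝ) 1) (hn : 1 ≤ n) {m : ℕ} (hnm : n ≤ m) :
    explorationParam d a b δ n ≤ explorationParam d a b δ m := by
  have hd' : (0 : ℝ) < d := Nat.cast_pos.2 hd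
  have hn' : (0 : ℝ) < n := Nat.cast_pos.2 hn
  have hnm' : (n : ℝ) ≤ m := Nat.cast_le.2 hnm
  have hδ0 := hδ.1
  have hsq : (n : ℝ) ^ 2 ≤ (m : ℝ) ^ 2 := by gcongr
  have hL : lipschitzParam d a b δ n ≤ lipschitzParam d a b δ m := by
    refine mul_le_mul_of_nonneg_left (Real.sqrt_le_sqrt (Real.log_le_log ?_ ?_)) hb.le
    · exact one_pos.trans (one_lt_log_argument hd ha hδ hn)
    · gcongr
  have hτ : resolution d a b δ n ≤ resolution d a b δ m :=
    mul_le_mul (mul_le_mul_of_nonneg_left hsq hd'.le) hL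
      (lipschitzParam_pos hd ha hb hδ hn).le (by positivity)
  rw [explorationParam_eq, explorationParam_eq]
  have h1 := Real.log_le_log (by positivity)
    (show Real.pi ^ 2 * (n : ℝ) ^ 2 / (2 * δ) ≤ Real.pi ^ 2 * (m : ℝ) ^ 2 / (2 * δ) by gcongr)
  have h2 := Real.log_le_log (resolution_pos hd ha hb hδ hn) hτ
  gcongr

/-- The left side is the union bound over a net of τ_n^d points, each with normal tail exp(-κ_n/2).
The two summands of κ_n are designed to make it a third of the failure budget of round `n`. -/
theorem exp_neg_explorationParam (hd : 1 ≤ d) (ha : 1 ≤ a) (hb : 0 < b)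
    (hδ : δ ∈ Set.Ioo (0 : ℝ) 1) (hn : 1 ≤ n) :
    resolution d a b δ n ^ d * Real.exp (-(explorationParam d a b δ n / 2)) =
      2 * δ / (Real.pi ^ 2 * (n : ℝ) ^ 2) := by
  have hn' : (0 : ℝ) < n := Nat.cast_pos.2 hn
  have hδ0 := hδ.1
  have hτ := resolution_pos hd ha hb hδ hn
  have he : -(explorationParam d a b δ n / 2) =
      -(Real.log (Real.pi ^ 2 * (n : ℝ) ^ 2 / (2 * δ))) +
        -((d : ℝ) * Real.log (resolution d a b δ n)) := by
    rw [explorationParam_eq]; ring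
  rw [he, Real.exp_add, Real.exp_neg, Real.exp_neg, Real.exp_log (by positivity), ← Real.log_pow,
    Real.exp_log (by positivity)]
  field_simp

theorem explorationParam_nonneg (hδ : δ ∈ Set.Ioo (0 : ℝ) 1) (hn : 1 ≤ n)
    (hτ : 1 ≤ resolution d a b δ n) : 0 ≤ explorationParam d a b δ n := by
  have hn' : (1 : ℝ) ≤ n := Nat.one_le_cast.2 hn
  have h2 : (9 : ℝ) ≤ Real.pi ^ 2 := by nlinarith [Real.pi_gt_three]
  have h3 : (1 : ℝ) ≤ (n : ℝ) ^ 2 := one_le_pow₀ hn'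
  rw [explorationParam_eq]
  have h1 : 0 ≤ Real.log (Real.pi ^ 2 * (n : ℝ) ^ 2 / (2 * δ)) := by
    refine Real.log_nonneg ?_
    rw [le_div_iff₀ (by linarith [hδ.1])]
    nlinarith [hδ.2]
  have := Real.log_nonneg hτ
  positivity

theorem mul_exp_neg_lipschitzParam (hd : 1 ≤ d) (ha : 1 ≤ a) (hb : 0 < b)
    (hδ : δ ∈ Set.Ioo (0 : ℝ) 1) (hn : 1 ≤ n) :
    d * (a * Real.exp (-(lipschitzParam d a b δ n / b) ^ 2)) =
      2 * δ / (Real.pi ^ 2 * (n : ℝ) ^ 2) := by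
  have hd' : (0 : ℝ) < d := Nat.cast_pos.2 hd
  have hn' : (0 : ℝ) < n := Nat.cast_pos.2 hn
  have hδ0 := hδ.1
  have ha0 : 0 < a := one_pos.trans_le ha
  have h1 := one_lt_log_argument hd ha hδ hn
  rw [lipschitzParam, mul_div_cancel_left₀ _ hb.ne', Real.sq_sqrt (Real.log_pos h1).le,
    Real.exp_neg, Real.exp_log (one_pos.trans h1)]
  field_simp

theorem sum_one_div_sq_le (N : ℕ) :
    ∑ n ∈ Finset.range N, 1 / ((n : ℝ) + 1) ^ 2 ≤ Real.pi ^ 2 / 6 := by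
  have h := hasSum_zeta_two
  have h1 := sum_le_hasSum (Finset.range (N + 1)) (fun i _ => by positivity) h
  -- The split-off term of index 0 is 1/0² = 0.
  rw [Finset.sum_range_succ'] at h1
  simpa using h1

theorem pi_sq_div_six_le_two : Real.pi ^ 2 / 6 ≤ 2 := by
  nlinarith [Real.pi_lt_d2, Real.pi_pos]

end

end TVGP

/-! ### Regret in one round and its summation -/

namespace TVGP

variable {d : ℕ} {D : Set (Fin d → ℝ)}

theorem IsCenteredGP.posSemidef_gram {Ω : Type*} [MeasurableSpace Ω] {P : Measure Ω}
    [IsProbabilityMeasure P] {k : (Fin d → ℝ) × ℕ → (Fin d → ℝ) × ℕ → ℝ}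
    {f : ℕ → Ω → (Fin d → ℝ) → ℝ} (hf : IsCenteredGP P k D f) {n : ℕ}
    (x : Fin n → (Fin d → ℝ) × ℕ) (hx : ∀ i, (x i).1 ∈ D) : (gram k x).PosSemidef :=
  posSemidef_of_covariance (ν := P) (X := fun i z => f (x i).2 z (x i).1)
    (fun i => (hf.gaussian.hasGaussianLaw_eval ((x i).2, ⟨(x i).1, hx i⟩)).memLp_two)
    fun i j => hf.covariance_eq _ _ _ (hx i) _ (hx j)

theorem productKernel_self (kβ : (Fin d → ℝ) → (Fin d → ℝ) → ℝ) (ω : ℝ) (p : (Fin d → ℝ) × ℕ) :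
    productKernel kβ ω p p = kβ p.1 p.1 := by
  simp [productKernel, timeKernel]

section InformationGain

variable {k : (Fin d → ℝ) × ℕ → (Fin d → ℝ) × ℕ → ℝ} {v : ℝ}

/-- Needed for `maxInfoGain` to dominate every design: the real supremum of an unbounded set is 0 by
convention. -/
theorem bddAbove_infoGain (hv : 0 < v) (hk : ∀ β ∈ D, ∀ t, k (β, t) (β, t) ≤ 1)
    (hps : ∀ (n : ℕ) (x : Fin n → (Fin d → ℝ) × ℕ), (∀ i, (x i).1 ∈ D) → (gram k x).PosSemidef)
    (n : ℕ) :
    BddAbove (Set.range fun β : Fin n → D =>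
      infoGain k v fun i => ((β i : Fin d → ℝ), (i : ℕ) + 1)) := by
  refine ⟨1 / 2 * (n * Real.log (1 + v⁻¹)), ?_⟩
  rintro _ ⟨β, rfl⟩
  let x : ℕ → (Fin d → ℝ) × ℕ := fun i => (if h : i < n then (β ⟨i, h⟩ : Fin d → ℝ) else 0, i + 1)
  have hx : (fun i : Fin n => ((β i : Fin d → ℝ), (i : ℕ) + 1)) = fun i : Fin n => x i := by
    funext i
    simp [x]
  have hxD : ∀ i < n, (x i).1 ∈ D := fun i hi => by
    simp only [x, dif_pos hi]
    exact (β ⟨i, hi⟩).2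
  beta_reduce
  rw [hx]
  exact infoGain_le hv n (hps n _ fun i => hxD i i.is_lt) fun i hi => hk _ (hxD i hi) _

theorem sum_posteriorVar_le_maxInfoGain (hv : 0 < v) (hk : ∀ β ∈ D, ∀ t, k (β, t) (β, t) ≤ 1)
    (hps : ∀ (n : ℕ) (x : Fin n → (Fin d → ℝ) × ℕ), (∀ i, (x i).1 ∈ D) → (gram k x).PosSemidef)
    (n : ℕ) {x : ℕ → Fin d → ℝ} (hx : ∀ i, x i ∈ D) :
    ∑ i ∈ Finset.range n, posteriorVar k v (fun j : Fin i => (x j, (j : ℕ) + 1)) (x i, i + 1) ≤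
      2 * maxInfoGain k v D n / Real.log (1 + v⁻¹) := by
  have hlog : 0 < Real.log (1 + v⁻¹) := Real.log_pos (by have := inv_pos.2 hv; linarith)
  rw [le_div_iff₀ hlog]
  refine (sum_posteriorVar_le (x := fun i => (x i, i + 1)) hv n (hps n _ fun i => hx i)
    fun i _ => hk _ (hx i) _).trans ?_
  exact mul_le_mul_of_nonneg_left
    (le_ciSup (bddAbove_infoGain hv hk hps n) fun i : Fin n => ⟨x i, hx i⟩) zero_le_two

end InformationGain

/-- From per-round regret bounds to a bound on the cumulative regret. -/
theorem sum_regret_le {N : ℕ} {r s κ : ℕ → ℝ} {V : ℝ}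
    (hr : ∀ n < N, r n ≤ 2 * (Real.sqrt (κ (n + 1)) * Real.sqrt (s n)) + 1 / ((n : ℝ) + 1) ^ 2)
    (hs : ∀ n < N, 0 ≤ s n) (hκ : ∀ n < N, κ (n + 1) ≤ κ N)
    (hV : ∑ n ∈ Finset.range N, s n ≤ V) :
    ∑ n ∈ Finset.range N, r n ≤ Real.sqrt (4 * V * κ N * N) + 2 := by
  have h1 : ∑ n ∈ Finset.range N, r n ≤
      2 * Real.sqrt (κ N) * ∑ n ∈ Finset.range N, Real.sqrt (s n) + 2 := by
    calc _ ≤ ∑ n ∈ Finset.range N, (2 * Real.sqrt (κ N) * Real.sqrt (s n) +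
          1 / ((n : ℝ) + 1) ^ 2) := by
          refine Finset.sum_le_sum fun n hn => ?_
          have hn' := Finset.mem_range.1 hn
          have := mul_le_mul_of_nonneg_right (Real.sqrt_le_sqrt (hκ n hn'))
            (Real.sqrt_nonneg (s n))
          linarith [hr n hn']
      _ ≤ _ := by
          rw [Finset.sum_add_distrib, Finset.mul_sum]
          linarith [sum_one_div_sq_le N, pi_sq_div_six_le_two]
  -- Cauchy–Schwarz.
  have h2 : ∑ n ∈ Finset.range N, Real.sqrt (s n) ≤ Real.sqrt (N * V) := by
    refine Real.le_sqrt_of_sq_le ?_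
    have h := sq_sum_le_card_mul_sum_sq (s := Finset.range N) (f := fun n => Real.sqrt (s n))
    rw [Finset.card_range, Finset.sum_congr rfl fun n hn =>
      Real.sq_sqrt (hs n (Finset.mem_range.1 hn))] at h
    exact h.trans (mul_le_mul_of_nonneg_left hV (Nat.cast_nonneg N))
  have h3 : 2 * Real.sqrt (κ N) * Real.sqrt (N * V) ≤ Real.sqrt (4 * V * κ N * N) := by
    rcases le_total 0 (κ N) with hκ0 | hκ0
    · have h4 : (2 : ℝ) = Real.sqrt 4 := by
        rw [show (4 : ℝ) = 2 ^ 2 by norm_num, Real.sqrt_sq zero_le_two]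
      nth_rewrite 1 [h4]
      rw [← Real.sqrt_mul (by norm_num), ← Real.sqrt_mul (by positivity)]
      exact le_of_eq (congrArg Real.sqrt (by ring))
    · rw [Real.sqrt_eq_zero_of_nonpos hκ0, mul_zero, zero_mul]
      exact Real.sqrt_nonneg _
  have h4 := mul_le_mul_of_nonneg_left h2 (show 0 ≤ 2 * Real.sqrt (κ N) by positivity)
  linarith

section Round

variable {Ω : Type*} [MeasurableSpace Ω] {P : Measure Ω}
  {f : ℕ → Ω → (Fin d → ℝ) → ℝ} {a b δ : ℝ} {N : ℕ}

theorem measure_gradient_event_le {g : Ω → (Fin d → ℝ) → Fin d → ℝ} (hd : 1 ≤ d) (ha : 1 ≤ a)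
    (hb : 0 < b) (hδ : δ ∈ Set.Ioo (0 : ℝ) 1) {n : ℕ} (hn : 1 ≤ n)
    (htail : ∀ j : Fin d, ∀ L : ℝ, 0 ≤ L →
      P {z | ENNReal.ofReal L ≤ ⨆ x ∈ D, ENNReal.ofReal |g z x j|} ≤
        ENNReal.ofReal (a * Real.exp (-(L / b) ^ 2))) :
    P {z | ¬ ∀ x ∈ D, ∀ j, |g z x j| ≤ lipschitzParam d a b δ n} ≤
      ENNReal.ofReal (2 * δ / (Real.pi ^ 2 * (n : ℝ) ^ 2)) := by
  have hL := lipschitzParam_pos hd ha hb hδ hn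
  have hsub : {z | ¬ ∀ x ∈ D, ∀ j, |g z x j| ≤ lipschitzParam d a b δ n} ⊆
      ⋃ j : Fin d, {z | ENNReal.ofReal (lipschitzParam d a b δ n) ≤
        ⨆ x ∈ D, ENNReal.ofReal |g z x j|} := by
    intro z hz
    rw [Set.mem_iUnion]
    by_contra! hall
    refine hz fun x hx j => ?_
    have h1 := hall j
    simp only [Set.mem_ofPred_eq, not_le] at h1
    have h2 := (le_iSup₂ (f := fun x (_ : x ∈ D) => ENNReal.ofReal |g z x j|) x hx).trans_lt h1
    exact ((ENNReal.ofReal_lt_ofReal_iff hL).1 h2).le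
  refine (measure_mono hsub).trans ((measure_iUnion_fintype_le _ _).trans ?_)
  refine (Finset.sum_le_sum fun j _ => htail j _ hL.le).trans_eq ?_
  rw [Finset.sum_const, Finset.card_univ, Fintype.card_fin, nsmul_eq_mul,
    ← mul_exp_neg_lipschitzParam hd ha hb hδ hn, ENNReal.ofReal_mul (Nat.cast_nonneg d),
    ENNReal.ofReal_natCast]

/-- For τ_n < 1 the parameter κ_n may be negative and the confidence argument fails. But the ℓ¹
diameter of `D` is at most d, so any arm has regret at most d L_n < 1/n². -/
theorem sSup_sub_le_of_resolution_lt_one (hsub : D ⊆ Set.Icc 0 1) (hne : D.Nonempty)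
    (hconv : Convex ℝ D) {n : ℕ} (hn : 1 ≤ n) {h : (Fin d → ℝ) → ℝ}
    {g : (Fin d → ℝ) → Fin d → ℝ} (hg : HasContinuousGradientOn h g D)
    (hL0 : 0 ≤ lipschitzParam d a b δ n)
    (hL : ∀ x ∈ D, ∀ j, |g x j| ≤ lipschitzParam d a b δ n)
    (hτ : resolution d a b δ n < 1) {y : Fin d → ℝ} (hy : y ∈ D) :
    sSup (h '' D) - h y ≤ 1 / (n : ℝ) ^ 2 := by
  have hn' : (0 : ℝ) < n := Nat.cast_pos.2 hn
  rw [sub_le_iff_le_add]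
  refine csSup_le (hne.image h) ?_
  rintro _ ⟨x, hx, rfl⟩
  have h1 := sub_le_of_gradient_bound hconv hg hL hx hy
  have h2 : ∑ j, |x j - y j| ≤ d := by
    have : ∀ j ∈ Finset.univ, |x j - y j| ≤ 1 := fun j _ => by
      have hx1 := (hsub hx).1 j
      have hx2 := (hsub hx).2 j
      have hy1 := (hsub hy).1 j
      have hy2 := (hsub hy).2 j
      simp only [Pi.zero_apply, Pi.one_apply] at hx1 hx2 hy1 hy2
      exact abs_le.2 ⟨by linarith, by linarith⟩
    simpa using Finset.sum_le_card_nsmul _ _ _ this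
  have h3 : lipschitzParam d a b δ n * d ≤ 1 / (n : ℝ) ^ 2 := by
    rw [le_div_iff₀ (by positivity)]
    rw [resolution] at hτ
    linarith
  linarith [mul_le_mul_of_nonneg_left h2 hL0]

/-- With s a net point near x: h(x) ≤ h(s) + L_n d/τ_n = h(s) + 1/n², then h(s) ≤ ucb(s) ≤ ucb(y) ≤
h(y) + 2cσ(y). Upper bounds are needed only on the net, a lower bound only at `y`. -/
theorem sSup_sub_le_of_confidence (hne : D.Nonempty)
    (hconv : Convex ℝ D) {n : ℕ} (hn : 1 ≤ n) {h : (Fin d → ℝ) → ℝ}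
    {g : (Fin d → ℝ) → Fin d → ℝ} (hg : HasContinuousGradientOn h g D)
    (hL0 : 0 ≤ lipschitzParam d a b δ n)
    (hL : ∀ x ∈ D, ∀ j, |g x j| ≤ lipschitzParam d a b δ n)
    (hτ : 1 ≤ resolution d a b δ n) {S : Finset (Fin d → ℝ)} (hSD : ∀ s ∈ S, s ∈ D)
    (hS : ∀ x ∈ D, ∃ s ∈ S, ∑ j, |x j - s j| ≤ d / resolution d a b δ n)
    {μ σ : (Fin d → ℝ) → ℝ} {c : ℝ} {y : Fin d → ℝ}
    (hmax : ∀ x ∈ D, μ x + c * σ x ≤ μ y + c * σ y)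
    (hup : ∀ s ∈ S, h s ≤ μ s + c * σ s) (hlow : μ y - c * σ y ≤ h y) :
    sSup (h '' D) - h y ≤ 2 * (c * σ y) + 1 / (n : ℝ) ^ 2 := by
  have hn' : (0 : ℝ) < n := Nat.cast_pos.2 hn
  rw [sub_le_iff_le_add]
  refine csSup_le (hne.image h) ?_
  rintro _ ⟨x, hx, rfl⟩
  obtain ⟨s, hsS, hs⟩ := hS x hx
  have h1 := sub_le_of_gradient_bound hconv hg hL hx (hSD s hsS)
  have h2 := mul_le_mul_of_nonneg_left hs hL0
  have h3 : lipschitzParam d a b δ n * (d / resolution d a b δ n) = 1 / (n : ℝ) ^ 2 := by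
    have hτ0 : resolution d a b δ n ≠ 0 := (one_pos.trans_le hτ).ne'
    rw [eq_div_iff (by positivity), mul_div_assoc', div_mul_eq_mul_div, div_eq_one_iff_eq hτ0,
      resolution]
    ring
  linarith [hup s hsS, hmax s (hSD s hsS)]

variable {v : ℝ≥0} {k : (Fin d → ℝ) × ℕ → (Fin d → ℝ) × ℕ → ℝ} {ε : ℕ → Ω → ℝ}
  {φ : (n : ℕ) → (Fin n → ℝ) → (Fin d → ℝ)}

/-- The instantaneous regret bound of GP-UCB in round `n + 1`. -/
theorem measure_round_failure_le [IsProbabilityMeasure P] (hsub : D ⊆ Set.Icc 0 1) (hne : D.Nonempty) (hc : IsCompact D)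
    (hconv : Convex ℝ D) (hf : IsCenteredGP P k D f) (hε : IsNoise P v D f ε) (hv : v ≠ 0)
    {f' : ℕ → Ω → (Fin d → ℝ) → Fin d → ℝ}
    (hf' : ∀ t ∈ Finset.Icc 1 N, ∀ᵐ z ∂P, HasContinuousGradientOn (f t z) (f' t z) D)
    (hd : 1 ≤ d) (ha : 1 ≤ a) (hb : 0 < b) (hδ : δ ∈ Set.Ioo (0 : ℝ) 1)
    (hφ : IsUCBPolicy k v (explorationParam d a b δ) D φ) {n : ℕ} (hn : n < N)
    (htail : ∀ j : Fin d, ∀ L : ℝ, 0 ≤ L →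
      P {z | ENNReal.ofReal L ≤ ⨆ x ∈ D, ENNReal.ofReal |f' (n + 1) z x j|} ≤
        ENNReal.ofReal (a * Real.exp (-(L / b) ^ 2))) :
    P {z | ¬ sSup (f (n + 1) z '' D) - f (n + 1) z (φ n (observations φ f ε n z)) ≤
      2 * (Real.sqrt (explorationParam d a b δ (n + 1)) *
        Real.sqrt (posteriorVar k v (visited φ n (observations φ f ε n z))
          (φ n (observations φ f ε n z), n + 1))) + 1 / ((n : ℝ) + 1) ^ 2} ≤
      ENNReal.ofReal (6 * δ / (Real.pi ^ 2 * ((n : ℝ) + 1) ^ 2)) := by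
  have hn1 : 1 ≤ n + 1 := Nat.le_add_left 1 n
  have hδ0 := hδ.1
  set η : ℝ := 2 * δ / (Real.pi ^ 2 * ((n : ℝ) + 1) ^ 2) with hη
  have hη0 : 0 ≤ η := by positivity
  have hcast : ((n + 1 : ℕ) : ℝ) = (n : ℝ) + 1 := by push_cast; rfl
  have hL0 := (lipschitzParam_pos hd ha hb hδ hn1).le
  have hE1 := measure_gradient_event_le (n := n + 1) (g := f' (n + 1)) hd ha hb hδ hn1 htail
  rw [hcast, ← hη] at hE1
  have hgrad := hf' (n + 1) (Finset.mem_Icc.2 ⟨hn1, by omega⟩)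
  -- One share each for the gradient, the upper bounds on the net, and the lower bound at the played
  -- arm.
  have h6 : 6 * δ / (Real.pi ^ 2 * ((n : ℝ) + 1) ^ 2) = η + (η + η) := by
    rw [hη]; ring
  rw [h6, ENNReal.ofReal_add hη0 (by positivity), ENNReal.ofReal_add hη0 hη0]
  set E1 := {z | ¬ ∀ x ∈ D, ∀ j, |f' (n + 1) z x j| ≤ lipschitzParam d a b δ (n + 1)} with hE1def
  rcases lt_or_ge (resolution d a b δ (n + 1)) 1 with hτ | hτ
  · refine le_trans (measure_mono_ae ?_) (hE1.trans le_self_add)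
    filter_upwards [hgrad] with z hz hbad
    intro hLz
    refine hbad ?_
    have h1 := sSup_sub_le_of_resolution_lt_one hsub hne hconv hn1 hz hL0 hLz hτ
      (hφ.mem n (observations φ f ε n z))
    rw [hcast] at h1
    refine h1.trans (le_add_of_nonneg_left ?_)
    positivity
  · have hκ := explorationParam_nonneg (d := d) (a := a) (b := b) hδ hn1 hτ
    set c := Real.sqrt (explorationParam d a b δ (n + 1)) with hcdef
    have hc0 : 0 ≤ c := Real.sqrt_nonneg _
    have hexp := exp_neg_explorationParam hd ha hb hδ hn1
    rw [hcast, ← hη, ← Real.sq_sqrt hκ, ← hcdef] at hexp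
    have hcont : ∀ t ∈ Finset.Icc 1 N, ∀ᵐ z ∂P, ContinuousOn (f t z) D := fun t ht =>
      (hf' t ht).mono fun z hz => hz.continuousOn
    have hm : 0 < ⌊resolution d a b δ (n + 1)⌋₊ := Nat.floor_pos.2 hτ
    obtain ⟨S, hSD, hScard, hSnet⟩ := exists_net hsub hne hc hconv hm
    have hSnet' : ∀ x ∈ D, ∃ s ∈ S, ∑ j, |x j - s j| ≤ d / resolution d a b δ (n + 1) := by
      intro x hx
      obtain ⟨s, hs, hxs⟩ := hSnet x hx
      refine ⟨s, hs, hxs.trans ?_⟩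
      have h1 := (Nat.lt_floor_add_one (resolution d a b δ (n + 1))).le
      have h2 : (1 : ℝ) ≤ ⌊resolution d a b δ (n + 1)⌋₊ := Nat.one_le_cast.2 hm
      -- With m the floor of τ and m ≥ 1, 2m ≥ m + 1 ≥ τ: the factor 2 gained by using midpoints
      -- pays for rounding down, so the net keeps at most τ^d points.
      exact div_le_div_of_nonneg_left (Nat.cast_nonneg d) (by linarith) (by linarith)
    set up : (Fin d → ℝ) → Set Ω := fun s =>
      {z | posteriorMean k v (visited φ n (observations φ f ε n z)) (observations φ f ε n z)
        (s, n + 1) + c * Real.sqrt (posteriorVar k v (visited φ n (observations φ f ε n z))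
          (s, n + 1)) < f (n + 1) z s} with hupdef
    set low : Set Ω := {z | f (n + 1) z (φ n (observations φ f ε n z)) <
      posteriorMean k v (visited φ n (observations φ f ε n z)) (observations φ f ε n z)
        (φ n (observations φ f ε n z), n + 1) -
      c * Real.sqrt (posteriorVar k v (visited φ n (observations φ f ε n z))
        (φ n (observations φ f ε n z), n + 1))} with hlowdef
    have hlow : P low ≤ ENNReal.ofReal η := by
      refine (measure_lower_deviation_le hf hε hcont hφ.measurable hφ.mem hv hn
        (β := fun y => ⟨φ n y, hφ.mem n y⟩) (hφ.measurable n).subtype_mk hc0).trans ?_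
      refine ENNReal.ofReal_le_ofReal ?_
      rw [← hexp]
      -- A single arm costs no more than the whole net, as τ^d ≥ 1.
      exact le_mul_of_one_le_left (Real.exp_pos _).le (one_le_pow₀ hτ)
    have hup : P (⋃ s ∈ S, up s) ≤ ENNReal.ofReal η := by
      refine (measure_biUnion_finset_le S up).trans ?_
      refine (Finset.sum_le_card_nsmul _ _ (ENNReal.ofReal (Real.exp (-(c ^ 2 / 2))))
        fun s hs => ?_).trans ?_
      · exact measure_upper_deviation_le hf hε hcont hφ.measurable hφ.mem hv hn
          (β := fun _ => ⟨s, hSD s hs⟩) measurable_const hc0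
      · rw [nsmul_eq_mul, ← ENNReal.ofReal_natCast, ← ENNReal.ofReal_mul (Nat.cast_nonneg _),
          ← hexp]
        refine ENNReal.ofReal_le_ofReal (mul_le_mul_of_nonneg_right ?_ (Real.exp_pos _).le)
        calc (S.card : ℝ) ≤ ((⌊resolution d a b δ (n + 1)⌋₊ ^ d : ℕ) : ℝ) := Nat.cast_le.2 hScard
          _ = (⌊resolution d a b δ (n + 1)⌋₊ : ℝ) ^ d := Nat.cast_pow _ _
          _ ≤ _ := pow_le_pow_left₀ (Nat.cast_nonneg _) (Nat.floor_le (by linarith)) d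
    have hU : P (E1 ∪ ((⋃ s ∈ S, up s) ∪ low)) ≤
        ENNReal.ofReal η + (ENNReal.ofReal η + ENNReal.ofReal η) :=
      (measure_union_le _ _).trans (add_le_add hE1
        ((measure_union_le _ _).trans (add_le_add hup hlow)))
    refine le_trans (measure_mono_ae ?_) hU
    filter_upwards [hgrad] with z hz hbad
    by_contra hgood
    refine hbad ?_
    have hgood1 : z ∉ E1 := fun h => hgood (Or.inl h)
    have hgood2 : ∀ s ∈ S, z ∉ up s := fun s hs h =>
      hgood (Or.inr (Or.inl (Set.mem_biUnion hs h)))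
    have hgood3 : z ∉ low := fun h => hgood (Or.inr (Or.inr h))
    have h1 := sSup_sub_le_of_confidence hne hconv hn1 hz hL0 (not_not.1 hgood1) hτ hSD hSnet'
      (μ := fun x => posteriorMean k v (visited φ n (observations φ f ε n z))
        (observations φ f ε n z) (x, n + 1))
      (σ := fun x => Real.sqrt (posteriorVar k v (visited φ n (observations φ f ε n z))
        (x, n + 1))) (c := c) (y := φ n (observations φ f ε n z))
      (fun x hx => hφ.argmax n _ x hx) (fun s hs => not_lt.1 (hgood2 s hs)) (not_lt.1 hgood3)
    rwa [hcast] at h1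

end Round

end TVGP

/-! ### Union bound over rounds and conclusion -/

namespace TVGP

theorem ofReal_one_sub_le_of_forall {Ω : Type*} [MeasurableSpace Ω] {P : Measure Ω}
    [IsProbabilityMeasure P] {δ : ℝ} (hδ : 0 ≤ δ) {p : Ω → Prop} (h : ∀ z, p z) :
    ENNReal.ofReal (1 - δ) ≤ P {z | p z} := by
  have : {z | p z} = Set.univ := Set.eq_univ_of_forall h
  rw [this, measure_univ]
  exact ENNReal.ofReal_le_one.2 (by linarith)

/-- Union bound over the rounds. -/
theorem ofReal_one_sub_le_of_rounds {Ω : Type*} [MeasurableSpace Ω] {P : Measure Ω}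
    [IsProbabilityMeasure P] {δ : ℝ} (hδ : 0 ≤ δ) {N : ℕ} {p : ℕ → Ω → Prop}
    (hp : ∀ n < N, P {z | ¬ p n z} ≤
      ENNReal.ofReal (6 * δ / (Real.pi ^ 2 * ((n : ℝ) + 1) ^ 2)))
    {q : Ω → Prop} (hq : ∀ z, (∀ n < N, p n z) → q z) :
    ENNReal.ofReal (1 - δ) ≤ P {z | q z} := by
  have hbad : P {z | ¬ q z} ≤ ENNReal.ofReal δ := by
    have hsub : {z | ¬ q z} ⊆ ⋃ n ∈ Finset.range N, {z | ¬ p n z} := by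
      intro z hz
      by_contra hcon
      refine hz (hq z fun n hn => ?_)
      by_contra hpn
      exact hcon (Set.mem_biUnion (Finset.mem_coe.2 (Finset.mem_range.2 hn)) hpn)
    refine (measure_mono hsub).trans ((measure_biUnion_finset_le _ _).trans ?_)
    refine (Finset.sum_le_sum fun n hn => hp n (Finset.mem_range.1 hn)).trans ?_
    rw [← ENNReal.ofReal_sum_of_nonneg fun n _ => by positivity]
    refine ENNReal.ofReal_le_ofReal ?_
    have hpi := Real.pi_pos
    have h : ∀ n ∈ Finset.range N, 6 * δ / (Real.pi ^ 2 * ((n : ℝ) + 1) ^ 2) =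
        6 * δ / Real.pi ^ 2 * (1 / ((n : ℝ) + 1) ^ 2) := fun n _ => by
      field_simp
    rw [Finset.sum_congr rfl h, ← Finset.mul_sum]
    refine (mul_le_mul_of_nonneg_left (sum_one_div_sq_le N) (by positivity)).trans_eq ?_
    field_simp
  -- Subadditivity replaces the complement rule, since the event `q` is not known to be measurable.
  have hone : (1 : ℝ≥0∞) ≤ P {z | q z} + P {z | ¬ q z} := by
    rw [← measure_univ (μ := P)]
    refine (measure_mono fun z _ => ?_).trans (measure_union_le _ _)
    exact Classical.em (q z)
  rw [ENNReal.ofReal_sub _ hδ, ENNReal.ofReal_one]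
  exact tsub_le_iff_right.2 (hone.trans (add_le_add_right hbad _))

end TVGP

theorem theorem1 {Ω : Type*} [MeasurableSpace Ω] (P : Measure Ω) [IsProbabilityMeasure P]
    {d : ℕ} (D : Set (Fin d → ℝ)) (hD_sub : D ⊆ Set.Icc 0 1) (hD_nonempty : D.Nonempty)
    (hD_compact : IsCompact D) (hD_convex : Convex ℝ D)
    (T w : ℕ) (hw : 0 < w) (hwT : w ∣ T)
    (kβ : (Fin d → ℝ) → (Fin d → ℝ) → ℝ) (hkβ : ∀ β ∈ D, kβ β β ≤ 1)
    (ω : ℝ) (hω : ω ∈ Set.Icc (0 : ℝ) 1)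
    (σf : ℝ≥0) (hσf : 0 < σf)
    (f : ℕ → Ω → (Fin d → ℝ) → ℝ)
    (hf : TVGP.IsCenteredGP P (TVGP.productKernel kβ ω) D f)
    (ε : ℕ → Ω → ℝ) (hε : TVGP.IsNoise P (σf ^ 2) D f ε)
    (f' : ℕ → Ω → (Fin d → ℝ) → Fin d → ℝ)
    (hf' : ∀ t ∈ Finset.Icc 1 (T / w), ∀ᵐ z ∂P, TVGP.HasContinuousGradientOn (f t z) (f' t z) D)
    (a b : ℝ) (ha : 0 < a) (hb : 0 < b)
    (htail : ∀ t ∈ Finset.Icc 1 (T / w), ∀ j : Fin d, ∀ L : ℝ, 0 ≤ L →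
      P {z | ENNReal.ofReal L ≤ ⨆ x ∈ D, ENNReal.ofReal |f' t z x j|} ≤
        ENNReal.ofReal (a * Real.exp (-(L / b) ^ 2)))
    (δ : ℝ) (hδ : δ ∈ Set.Ioo (0 : ℝ) 1)
    (φ : (n : ℕ) → (Fin n → ℝ) → (Fin d → ℝ))
    (hφ : TVGP.IsUCBPolicy (TVGP.productKernel kβ ω) ((σf : ℝ) ^ 2)
      (TVGP.explorationParam d a b δ) D φ) :
    ENNReal.ofReal (1 - δ) ≤
      P {z | TVGP.cumulativeRegret φ D (fun t => f t z) (fun t => ε t z) (T / w) ≤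
        Real.sqrt (TVGP.maxInfoGain (TVGP.productKernel kβ ω) ((σf : ℝ) ^ 2) D (T / w) *
          (8 / Real.log (1 + ((σf : ℝ) ^ 2)⁻¹)) *
          TVGP.explorationParam d a b δ (T / w) * ((T : ℝ) / (w : ℝ))) + 2} := by
  set N := T / w with hN
  have hTw : (T : ℝ) / (w : ℝ) = (N : ℝ) :=
    (Nat.cast_div hwT (Nat.cast_ne_zero.2 hw.ne')).symm
  rw [hTw]
  -- In dimension 0 the set `D` is a single point and the regret vanishes.
  rcases Nat.eq_zero_or_pos d with rfl | hd
  · refine TVGP.ofReal_one_sub_le_of_forall hδ.1.le fun z => ?_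
    have hr : TVGP.cumulativeRegret φ D (fun t => f t z) (fun t => ε t z) N = 0 := by
      refine Finset.sum_eq_zero fun n _ => ?_
      have hD1 : D = {TVGP.pulled φ (fun t => f t z) (fun t => ε t z) n} :=
        Set.eq_singleton_iff_unique_mem.2 ⟨hφ.mem _ _, fun x _ => Subsingleton.elim _ _⟩
      nth_rewrite 1 [hD1]
      rw [Set.image_singleton, csSup_singleton, sub_self]
    rw [hr]
    positivity
  rcases Nat.eq_zero_or_pos N with hN0 | hNpos
  · refine TVGP.ofReal_one_sub_le_of_forall hδ.1.le fun z => ?_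
    have hr : TVGP.cumulativeRegret φ D (fun t => f t z) (fun t => ε t z) N = 0 := by
      rw [hN0, TVGP.cumulativeRegret, Finset.sum_range_zero]
    rw [hr]
    positivity
  -- At L = 0 the tail event is the whole space, so the tail bound forces a ≥ 1. This needs a round
  -- and a coordinate, hence the two cases split off above.
  have ha1 : 1 ≤ a := by
    have h := htail 1 (Finset.mem_Icc.2 ⟨le_rfl, hNpos⟩) ⟨0, hd⟩ 0 le_rfl
    simpa using h
  have hσ : 0 < (σf : ℝ) ^ 2 := pow_pos (NNReal.coe_pos.2 hσf) 2
  have hps : ∀ (n : ℕ) (x : Fin n → (Fin d → ℝ) × ℕ), (∀ i, (x i).1 ∈ D) →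
      (TVGP.gram (TVGP.productKernel kβ ω) x).PosSemidef := fun n x hx => hf.posSemidef_gram x hx
  have hk1 : ∀ β ∈ D, ∀ t, TVGP.productKernel kβ ω (β, t) (β, t) ≤ 1 := fun β hβ t => by
    rw [TVGP.productKernel_self]
    exact hkβ β hβ
  have hφ' : TVGP.IsUCBPolicy (TVGP.productKernel kβ ω) ((σf ^ 2 : ℝ≥0) : ℝ)
      (TVGP.explorationParam d a b δ) D φ := by
    rwa [NNReal.coe_pow]
  refine TVGP.ofReal_one_sub_le_of_rounds (N := N) hδ.1.le (fun n hn =>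
    TVGP.measure_round_failure_le hD_sub hD_nonempty hD_compact hD_convex hf hε
      (pow_pos hσf 2).ne' hf' hd ha1 hb hδ hφ' hn (htail (n + 1) (Finset.mem_Icc.2
        ⟨Nat.le_add_left 1 n, hn⟩))) fun z hz => ?_
  simp only [NNReal.coe_pow] at hz
  have hV := TVGP.sum_posteriorVar_le_maxInfoGain hσ hk1 hps N
    (x := fun n => TVGP.pulled φ (fun t => f t z) (fun t => ε t z) n) fun n => hφ.mem _ _
  refine (TVGP.sum_regret_le (N := N) (κ := TVGP.explorationParam d a b δ) hz (fun n _ => ?_)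
    (fun n hn => TVGP.explorationParam_mono hd ha1 hb hδ (Nat.le_add_left 1 n) hn) hV).trans_eq ?_
  · exact TVGP.posteriorVar_nonneg
      (x := fun n => (TVGP.pulled φ (fun t => f t z) (fun t => ε t z) n, n + 1)) hσ n
      (hps (n + 1) _ fun i => hφ.mem _ _)
  -- The constants combine as 4 · 2/log(1 + σ_f⁻²) = C_1.
  · congr 2
    ring
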